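/- Let $\mathbb E_n$ be the space of positive definite real symmetric $n\times n$ matrices with the Riemannian metric $ds^2=\operatorname{tr}(dX\,X^{-1}\,dX\,X^{-1})$ and its geodesic distance $\rho$. A geodesic means a nonconstant complete directed geodesic, i.e. a geodesic considered up to changes of parameter $t\mapsto at+b$, $a>0$. The null pencil of a geodesic $\mu$ is the set of all geodesics $\nu$ such that for every $S\in\mathbb R$ $$\lim_{t\to+\infty}\ \inf_{s\ge S}\rho(\mu(t),\nu(s))=0 .$$ A boundary datum consists of: 1. a set $I=\{0=i_0<i_1<\dots<i_m=n\}\subset\{0,1,\dots,n\}$; 2. a point of the simplex $\Delta(I)$, i.e. a collection $\psi_1>\psi_2>\dots>\psi_m$ of real numbers, not all zero, defined up to a joint positive factor; 3. a flag $\mathbb R^n=W_0\supset W_1\supset\dots\supset W_m=0$ with $\operatorname{codim}W_k=i_k$, i.e. a point of $\mathcal F(I)$; 4. a family $(R_1,\dots,R_m)$ of positive definite quadratic forms, $R_k$ on $W_{k-1}/W_k$, defined up to the replacements $(R_1,\dots,R_m)\rightsquigarrow(e^{\psi_1 s}R_1,\dots,e^{\psi_m s}R_m)$, $s\in\mathbb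 R$. A geodesic $\mu$ with a fixed affine parameter $t$ determines a boundary datum as follows. Write $\mu(t)=g\,\mathrm{diag}(e^{\varphi_1t},\dots,e^{\varphi_nt})\,g^\top$ with $g\in\mathrm{GL}(n,\mathbb R)$ and $\varphi_1\ge\dots\ge\varphi_n$. Let $\psi_1>\dots>\psi_m$ be the distinct values of the $\varphi_i$, and let $I$ be such that $\varphi_i=\psi_k$ for $i_{k-1}<i\le i_k$. For large $t$ let $W_k(t)$ be the span of the eigenvectors of $\mu(t)$ corresponding to its $n-i_k$ smallest eigenvalues, and let $W_k=\lim_{t\to+\infty}W_k(t)$. Let $Q_t(v)=\frac12 v^\top\mu(t)v$. Identify $W_{k-1}(t)$ with $W_{k-1}$ by orthogonal operators tending to the identity. The limit as $t\to+\infty$ of $e^{-\psi_kt}\,Q_t|_{W_{k-1}(t)}$ is then a quadratic form on $W_{k-1}$ that is induced by a positive definite form $R_k$ on $W_{k-1}/W_k$. **Theorem.** For every $n$, each geodesic has exactly one boundary datum in this sense, the datum depends only on the null pencil of the geodesic, and the resulting map is a bijection from the set of all null pencils in $\mathbb E_n$ onto the set of all boundary data 1–4. -/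

import Mathlib

open Filter Topology

noncomputable section

namespace PosDefSpace

/-! ### The Riemannian manifold of positive definite matrices -/

/-- The Riemannian metric `tr (dX · X⁻¹ · dX · X⁻¹)` (as a bilinear form on tangent vectors `U`, `V`,
which are symmetric matrices) at the point `X`. -/
def metric {n : ℕ} (X U V : Matrix (Fin n) (Fin n) ℝ) : ℝ :=
  (U * X⁻¹ * V * X⁻¹).trace

/-- The velocity vector of a curve of matrices, computed entrywise. -/
def velocity {n : ℕ} (c : ℝ → Matrix (Fin n) (Fin n) ℝ) (t : ℝ) : Matrix (Fin n) (Fin n) ℝ :=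
  Matrix.of fun i j => deriv (fun s => c s i j) t

/-- The Riemannian length of a curve over the parameter interval `[0, 1]`. -/
def length {n : ℕ} (c : ℝ → Matrix (Fin n) (Fin n) ℝ) : ℝ :=
  ∫ t in (0 : ℝ)..1, Real.sqrt (metric (c t) (velocity c t) (velocity c t))

/-- `c` is a `C¹` curve which on `[0, 1]` runs in the space of positive definite matrices
from `X` to `Y`. -/
structure IsPath {n : ℕ} (X Y : Matrix (Fin n) (Fin n) ℝ)
    (c : ℝ → Matrix (Fin n) (Fin n) ℝ) : Prop where
  smooth : ∀ i j, ContDiff ℝ 1 fun t => c t i j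
  posDef : ∀ t ∈ Set.Icc (0 : ℝ) 1, (c t).PosDef
  source : c 0 = X
  target : c 1 = Y

/-- The Riemannian distance: the infimum of the lengths of curves joining two points. -/
def rho {n : ℕ} (X Y : Matrix (Fin n) (Fin n) ℝ) : ℝ :=
  sInf {L | ∃ c, IsPath X Y c ∧ L = length c}

/-- A nonconstant complete geodesic with an affine parameter.  The geodesic equation is
the Euler-Lagrange equation of the Lagrangian `½ metric X X' X'`, tested against all
directions `V`:  `d/dt (∂L/∂X' · V) = ∂L/∂X · V`. -/
structure ParamGeodesic (n : ℕ) where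
  toFun : ℝ → Matrix (Fin n) (Fin n) ℝ
  posDef : ∀ t, (toFun t).PosDef
  smooth : ∀ i j, ContDiff ℝ 2 fun t => toFun t i j
  geodesic_eq : ∀ V : Matrix (Fin n) (Fin n) ℝ, V.IsSymm → ∀ t : ℝ,
    HasDerivAt (fun s => metric (toFun s) (velocity toFun s) V)
      ((1 / 2) * deriv
        (fun ε : ℝ => metric (toFun t + ε • V) (velocity toFun t) (velocity toFun t)) 0) t
  nonconst : ∃ s t, toFun s ≠ toFun t

/-- Two parametrized geodesics represent one directed geodesic when they differ by an
orientation preserving affine change of the parameter. -/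
def directedSetoid (n : ℕ) : Setoid (ParamGeodesic n) where
  r μ ν := ∃ a b : ℝ, 0 < a ∧ ∀ t, ν.toFun t = μ.toFun (a * t + b)
  iseqv :=
    { refl := fun _ => ⟨1, 0, one_pos, fun t => by simp⟩
      symm := by
        rintro μ ν ⟨a, b, ha, h⟩
        refine ⟨a⁻¹, -(a⁻¹ * b), inv_pos.2 ha, fun t => ?_⟩
        rw [h]
        congr 1
        field_simp
        ring
      trans := by
        rintro μ ν κ ⟨a, b, ha, h⟩ ⟨a', b', ha', h'⟩
        refine ⟨a * a', a * b' + b, mul_pos ha ha', fun t => ?_⟩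
        rw [h', h]
        congr 1
        ring }

/-- Directed geodesics. -/
def DirectedGeodesic (n : ℕ) : Type := Quotient (directedSetoid n)

/-- The directed geodesic represented by a parametrized one. -/
def ParamGeodesic.toDirected {n : ℕ} (μ : ParamGeodesic n) : DirectedGeodesic n :=
  Quotient.mk (directedSetoid n) μ

/-- The distance from a point to the forward half `{ν(s) : s ≥ S}` of a directed geodesic. -/
def distForward {n : ℕ} (X : Matrix (Fin n) (Fin n) ℝ) (ν : ParamGeodesic n) (S : ℝ) : ℝ :=
  sInf {d | ∃ s, S ≤ s ∧ d = rho X (ν.toFun s)}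

/-- The distance from `μ(t)` to the directed geodesic `ν` tends to `0` as `t → +∞`.
Since geodesics are directed, the distance is taken to the forward halves of `ν`. -/
def NullAsymptotic {n : ℕ} (μ ν : ParamGeodesic n) : Prop :=
  ∀ S : ℝ, Tendsto (fun t => distForward (μ.toFun t) ν S) atTop (𝓝 0)

/-- The null pencil of `μ`, a set of directed geodesics. -/
def nullPencil {n : ℕ} (μ : ParamGeodesic n) : Set (DirectedGeodesic n) :=
  {N | ∃ ν : ParamGeodesic n, ν.toDirected = N ∧ NullAsymptotic μ ν}

/-- The space of all null pencils. -/
def NullPencil (n : ℕ) : Type :=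
  {P : Set (DirectedGeodesic n) // ∃ μ : ParamGeodesic n, nullPencil μ = P}

/-- The null pencil of `μ` as a point of the space of null pencils. -/
def ParamGeodesic.toNullPencil {n : ℕ} (μ : ParamGeodesic n) : NullPencil n :=
  ⟨nullPencil μ, μ, rfl⟩

/-! ### Boundary data

A subset `I = {0 = i₀ < i₁ < ⋯ < i_m = n}` of `{0, …, n}` is a term of Mathlib's
`CompositionAsSet n`; then `I.length = m`. -/

/-- The element `i_k` of `I`. -/
def cut {n : ℕ} (I : CompositionAsSet n) (k : Fin (I.length + 1)) : Fin (n + 1) :=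
  I.boundaries.orderEmbOfFin I.card_boundaries_eq_succ_length k

/-- Collections `ψ₁ > ⋯ > ψ_m`, not all zero. -/
def Speeds {n : ℕ} (I : CompositionAsSet n) : Type :=
  {ψ : Fin I.length → ℝ // StrictAnti ψ ∧ ψ ≠ 0}

/-- Proportionality of collections with a positive factor. -/
def speedsSetoid {n : ℕ} (I : CompositionAsSet n) : Setoid (Speeds I) where
  r ψ φ := ∃ a : ℝ, 0 < a ∧ ∀ k, φ.1 k = a * ψ.1 k
  iseqv :=
    { refl := fun _ => ⟨1, one_pos, fun k => by simp⟩
      symm := by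
        rintro ψ φ ⟨a, ha, h⟩
        exact ⟨a⁻¹, inv_pos.2 ha, fun k => by rw [h]; field_simp⟩
      trans := by
        rintro ψ φ χ ⟨a, ha, h⟩ ⟨b, hb, h'⟩
        exact ⟨b * a, mul_pos hb ha, fun k => by rw [h', h]; ring⟩ }

/-- The simplex `Δ(I)`. -/
def Simplex {n : ℕ} (I : CompositionAsSet n) : Type := Quotient (speedsSetoid I)

/-- The point of the simplex represented by a collection. -/
def Speeds.toSimplex {n : ℕ} {I : CompositionAsSet n} (ψ : Speeds I) : Simplex I :=
  Quotient.mk (speedsSetoid I) ψ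

/-- The flags `ℝⁿ = W₀ ⊃ W₁ ⊃ ⋯ ⊃ W_m = 0` with `codim W_k = i_k`. -/
def Flag {n : ℕ} (I : CompositionAsSet n) : Type :=
  {W : Fin (I.length + 1) → Submodule ℝ (Fin n → ℝ) //
    Antitone W ∧ ∀ k, Module.finrank ℝ (W k) + (cut I k : ℕ) = n}

/-- The `k`-th subquotient `W_k / W_{k+1}` of a flag, `0 ≤ k < m`. -/
abbrev Flag.Subquot {n : ℕ} {I : CompositionAsSet n} (W : Flag I) (k : Fin I.length) : Type :=
  (W.1 k.castSucc) ⧸ (W.1 k.succ).submoduleOf (W.1 k.castSucc)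

/-- Families of positive definite quadratic forms on the subquotients of a flag. -/
def Forms {n : ℕ} {I : CompositionAsSet n} (W : Flag I) : Type :=
  ∀ k : Fin I.length, {R : QuadraticForm ℝ (W.Subquot k) // R.PosDef}

/-- Two families of forms are equivalent with respect to the point `δ` of the simplex when
they differ by a rescaling `(e^{ψ₁ s}, …, e^{ψ_m s})`, where `ψ` represents `δ` and `s` is real
(replacing `ψ` by a proportional collection only changes `s`). -/
def formsSetoid {n : ℕ} {I : CompositionAsSet n} (δ : Simplex I) (W : Flag I) :
    Setoid (Forms W) where
  r R R' := ∃ ψ : Speeds I, ψ.toSimplex = δ ∧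
    ∃ s : ℝ, ∀ k, ∀ x : W.Subquot k, (R' k).1 x = Real.exp (ψ.1 k * s) * (R k).1 x
  iseqv :=
    { refl := by
        intro R
        obtain ⟨ψ, hψ⟩ := Quotient.exists_rep δ
        exact ⟨ψ, hψ, 0, fun k x => by simp⟩
      symm := by
        rintro R R' ⟨ψ, hψ, s, h⟩
        refine ⟨ψ, hψ, -s, fun k x => ?_⟩
        rw [h, ← mul_assoc, ← Real.exp_add]
        simp
      trans := by
        rintro R R' R'' ⟨ψ, hψ, s, h⟩ ⟨φ, hφ, s', h'⟩
        obtain ⟨a, -, ha⟩ : (speedsSetoid I).r ψ φ := Quotient.exact (hψ.trans hφ.symm)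
        refine ⟨ψ, hψ, s + a * s', fun k x => ?_⟩
        rw [h', h, ha, ← mul_assoc, ← Real.exp_add]
        congr 2
        ring }

/-- Families of forms up to rescaling. -/
def FormsClass {n : ℕ} {I : CompositionAsSet n} (δ : Simplex I) (W : Flag I) : Type :=
  Quotient (formsSetoid δ W)

/-- The boundary data: a subset, a point of its simplex, a flag, and a class of families of
positive definite forms on the subquotients of the flag. -/
structure BoundaryData (n : ℕ) where
  I : CompositionAsSet n
  δ : Simplex I
  W : Flag I
  R : FormsClass δ W

/-! ### The boundary data of a geodesic -/

/-- The velocity of `μ`, for the given parameter: `μ(t) = g diag(e^{φ_1 t}, …, e^{φ_n t}) gᵀ`, where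
the vector `φ` has the value `ψ_k` at the positions of the `k`-th block cut out by `I`. -/
def HasVelocity {n : ℕ} (μ : ParamGeodesic n) (I : CompositionAsSet n) (ψ : Speeds I) : Prop :=
  ∃ φ : Fin n → ℝ,
    (∀ (k : Fin I.length) (i : Fin n),
      (cut I k.castSucc : ℕ) ≤ i → (i : ℕ) < cut I k.succ → φ i = ψ.1 k) ∧
    ∃ g : GL (Fin n) ℝ, ∀ t : ℝ,
      μ.toFun t = (g : Matrix (Fin n) (Fin n) ℝ) *
        Matrix.diagonal (fun i => Real.exp (φ i * t)) * (g : Matrix (Fin n) (Fin n) ℝ).transpose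

/-- The quadratic form `½ ∑ x_{ij} v_i v_j`. -/
def quadForm {n : ℕ} (X : Matrix (Fin n) (Fin n) ℝ) (v : Fin n → ℝ) : ℝ :=
  (1 / 2) * ∑ i, ∑ j, X i j * v i * v j

/-- The span of the eigenvectors of `X` whose eigenvalues are not among the `d` largest ones:
at least `d` eigenvalues, counted with multiplicity, are strictly larger. -/
def spectralTail {n : ℕ} (X : Matrix (Fin n) (Fin n) ℝ) (d : ℕ) : Submodule ℝ (Fin n → ℝ) :=
  Submodule.span ℝ {v | ∃ l : ℝ, X.mulVec v = l • v ∧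
    d ≤ (X.charpoly.roots.filter fun l' => l < l').card}

/-- `μ` (with its parameter) has literal limit data `ψ`, `W`, `R`: its velocity is `ψ`; for every
`k` the subspaces `W_k(t)` spanned by the eigenvectors of `μ(t)` for the packets of eigenvalues after
the first `k` ones converge to `W_k`; and `e^{-ψ t}` times the restriction of the form of `μ(t)` to
`W_k(t)` converges to a form on `W_k` that is induced by the given form on `W_k / W_{k+1}`.
The convergence is understood after an identification of `W_k(t)` with `W_k` by
orthogonal operators `h(t)` tending to `1`. -/
def HasLimitData {n : ℕ} (μ : ParamGeodesic n) {I : CompositionAsSet n} (ψ : Speeds I)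
    (W : Flag I) (R : Forms W) : Prop :=
  HasVelocity μ I ψ ∧
  ∀ k : Fin I.length, ∃ h : ℝ → Matrix.orthogonalGroup (Fin n) ℝ,
    Tendsto (fun t => (h t : Matrix (Fin n) (Fin n) ℝ)) atTop (𝓝 1) ∧
    (∀ᶠ t in atTop,
      (spectralTail (μ.toFun t) (cut I k.castSucc)).map
        (Matrix.toLin' (h t : Matrix (Fin n) (Fin n) ℝ)) = W.1 k.castSucc) ∧
    ∀ v : W.1 k.castSucc,
      Tendsto
        (fun t => Real.exp (-(ψ.1 k * t)) * quadForm (μ.toFun t)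
          ((h t : Matrix (Fin n) (Fin n) ℝ)⁻¹.mulVec (v : Fin n → ℝ)))
        atTop (𝓝 ((R k).1 (Submodule.Quotient.mk v)))

/-- `b` is the boundary datum of the geodesic `μ`. -/
def HasBoundaryData {n : ℕ} (μ : ParamGeodesic n) (b : BoundaryData n) : Prop :=
  ∃ (ψ : Speeds b.I) (R : Forms b.W), HasLimitData μ ψ b.W R ∧
    ψ.toSimplex = b.δ ∧ Quotient.mk (formsSetoid b.δ b.W) R = b.R

end PosDefSpace

end

/-!
Geodesics are the curves `g exp(t diag φ) gᵀ`, and the distance `ρ X Y` bounds the logarithms of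
the ratios of the quadratic forms of `X` and `Y`.  Hence geodesics of the same
null pencil have quadratic forms whose ratio tends to `1` along suitable parameters; their growth
rates give the speeds and the flag, and the leading coefficients give the forms.  Conversely, two
frames `g`, `h` with the same datum satisfy `h = g b` with `b` block triangular and with orthogonal
diagonal blocks, and conjugation with `exp(t diag φ / 2)` contracts the off-diagonal part of `b`, so
that the distance between the two geodesics tends to `0`.

The spectral limits that define the datum are governed by the estimate
`|(gᵀ U(t)) i j| ≤ K exp((φ j - φ i) t)` for orthonormal eigenvectors `U(t)` of the geodesic: the
eigenspaces converge exponentially to the flag of `g`.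
-/

noncomputable section

namespace PosDefSpace

open Matrix

section MatrixCalculus

theorem tendsto_matrix_iff {ι α : Type*} {l : Filter α} {f : α → Matrix ι ι ℝ} {A : Matrix ι ι ℝ} :
    Tendsto f l (𝓝 A) ↔ ∀ i j, Tendsto (fun a => f a i j) l (𝓝 (A i j)) :=
  tendsto_pi_nhds.trans (forall_congr' fun _ => tendsto_pi_nhds)

variable {ι : Type*} {X Y : ℝ → Matrix ι ι ℝ} {X' Y' : Matrix ι ι ℝ} {t : ℝ}

theorem hasDerivAt_matrix_iff [Finite ι] :
    HasDerivAt X X' t ↔ ∀ i j, HasDerivAt (fun s => X s i j) (X' i j) t := by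
  have := Fintype.ofFinite ι
  exact hasDerivAt_pi.trans (forall_congr' fun _ => hasDerivAt_pi)

theorem isSymm_of_hasDerivAt [Finite ι] (h : HasDerivAt X X' t)
    (hX : ∀ᶠ s in 𝓝 t, (X s).IsSymm) : X'.IsSymm := by
  have h := hasDerivAt_matrix_iff.1 h
  ext i j
  exact (h j i).unique ((h i j).congr_of_eventuallyEq (hX.mono fun s hs => hs.apply i j))

theorem eq_of_forall_hasDerivAt_zero [Finite ι] (h : ∀ s, HasDerivAt X 0 s) (s t : ℝ) :
    X s = X t := by
  ext i j
  have h s := hasDerivAt_matrix_iff.1 (h s) i j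
  exact is_const_of_deriv_eq_zero (fun s => (h s).differentiableAt) (fun s => (h s).deriv) s t

variable [Fintype ι]

theorem hasDerivAt_trace (h : HasDerivAt X X' t) :
    HasDerivAt (fun s => (X s).trace) X'.trace t :=
  HasDerivAt.fun_sum fun i _ => hasDerivAt_matrix_iff.1 h i i

open scoped Matrix.Norms.Operator in
theorem hasDerivAt_mul (hX : HasDerivAt X X' t) (hY : HasDerivAt Y Y' t) :
    HasDerivAt (fun s => X s * Y s) (X' * Y t + X t * Y') t := by
  classical exact HasDerivAt.mul hX hY

open scoped Matrix.Norms.Operator in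
theorem hasDerivAt_const_mul (A : Matrix ι ι ℝ) (hX : HasDerivAt X X' t) :
    HasDerivAt (fun s => A * X s) (A * X') t := by
  classical exact HasDerivAt.const_mul A hX

open scoped Matrix.Norms.Operator in
theorem hasDerivAt_mul_const (hX : HasDerivAt X X' t) (A : Matrix ι ι ℝ) :
    HasDerivAt (fun s => X s * A) (X' * A) t := by
  classical exact HasDerivAt.mul_const hX A

variable [DecidableEq ι]

theorem tendsto_inv {α : Type*} {l : Filter α} {f : α → Matrix ι ι ℝ} {A : Matrix ι ι ℝ}
    (hA : IsUnit A) (hf : Tendsto f l (𝓝 A)) : Tendsto (fun a => (f a)⁻¹) l (𝓝 A⁻¹) :=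
  (continuousAt_matrix_inv A (NormedRing.inverse_continuousAt
    ((isUnit_iff_isUnit_det A).1 hA).unit)).tendsto.comp hf

open scoped Matrix.Norms.Operator in
theorem hasDerivAt_inv (hX : HasDerivAt X X' t) (hu : IsUnit (X t)) :
    HasDerivAt (fun s => (X s)⁻¹) (-((X t)⁻¹ * X' * (X t)⁻¹)) t := by
  obtain ⟨u, hu⟩ := hu
  have hinv := hasFDerivAt_ringInverse (𝕜 := ℝ) u
  rw [hu] at hinv
  simp only [nonsing_inv_eq_ringInverse, ← hu, Ring.inverse_unit]
  exact hinv.comp_hasDerivAt t hX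

theorem eq_of_hasDerivAt_mul {M : Matrix ι ι ℝ} (hX : ∀ t, HasDerivAt X (X t * M) t)
    (hY : ∀ t, HasDerivAt Y (Y t * M) t) (hu : ∀ t, IsUnit (Y t)) (h0 : X 0 = Y 0) : X = Y := by
  have hdet t : IsUnit (Y t).det := (isUnit_iff_isUnit_det _).1 (hu t)
  have hconst : ∀ t, HasDerivAt (fun s => X s * (Y s)⁻¹) 0 t := by
    intro t
    convert hasDerivAt_mul (hX t) (hasDerivAt_inv (hY t) (hu t)) using 1
    rw [← Matrix.mul_assoc (Y t)⁻¹, nonsing_inv_mul _ (hdet t), Matrix.one_mul, Matrix.mul_neg,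
      Matrix.mul_assoc, add_neg_cancel]
  ext1 t
  have h1 : X t * (Y t)⁻¹ = 1 := by
    rw [eq_of_forall_hasDerivAt_zero hconst t 0, h0, mul_nonsing_inv _ (hdet 0)]
  rw [← Matrix.mul_one (X t), ← nonsing_inv_mul _ (hdet t), ← Matrix.mul_assoc, h1, Matrix.one_mul]

end MatrixCalculus

section Congruence

variable {ι R : Type*} [Fintype ι] [CommRing R]

/-- The congruence action `X ↦ g X gᵀ`; for invertible `g` it preserves the positive definite
matrices and acts on them by isometries. -/
def congruence (g X : Matrix ι ι R) : Matrix ι ι R := g * X * gᵀ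

theorem congruence_congruence (g h X : Matrix ι ι R) :
    congruence g (congruence h X) = congruence (g * h) X := by
  simp only [congruence, transpose_mul, Matrix.mul_assoc]

theorem congruence_sub (g X Y : Matrix ι ι R) :
    congruence g (X - Y) = congruence g X - congruence g Y := by
  simp only [congruence, Matrix.mul_sub, Matrix.sub_mul]

theorem isSymm_congruence (g : Matrix ι ι R) {X : Matrix ι ι R} (hX : X.IsSymm) :
    (congruence g X).IsSymm := by
  simp only [IsSymm, congruence, transpose_mul, transpose_transpose, hX.eq, Matrix.mul_assoc]

variable [DecidableEq ι]

theorem one_congruence (X : Matrix ι ι R) : congruence 1 X = X := by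
  simp [congruence]

theorem inv_congruence_congruence (g : GL ι R) (X : Matrix ι ι R) :
    congruence (g⁻¹).1 (congruence g.1 X) = X := by
  rw [congruence_congruence, Units.inv_mul, one_congruence]

theorem congruence_inv_congruence (g : GL ι R) (X : Matrix ι ι R) :
    congruence g.1 (congruence (g⁻¹).1 X) = X := by
  rw [congruence_congruence, Units.mul_inv, one_congruence]

theorem congruence_mul (g : GL ι R) (X Y : Matrix ι ι R) :
    congruence g.1 X * ((g⁻¹).1ᵀ * Y * g.1ᵀ) = congruence g.1 (X * Y) := by
  have hg : g.1ᵀ * (g⁻¹).1ᵀ = 1 := by rw [← transpose_mul, Units.inv_mul, transpose_one]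
  simp only [congruence, Matrix.mul_assoc]
  rw [← Matrix.mul_assoc g.1ᵀ, hg, Matrix.one_mul]

theorem congruence_orthogonal_one (U : orthogonalGroup ι R) : congruence U.1 1 = 1 := by
  rw [congruence, Matrix.mul_one]
  exact (mem_orthogonalGroup_iff _ _).1 U.2

theorem posDef_congruence {X : Matrix ι ι ℝ} (hX : X.PosDef) (g : GL ι ℝ) :
    (congruence g.1 X).PosDef := by
  rw [congruence, ← conjTranspose_eq_transpose_of_trivial]
  exact hX.mul_mul_conjTranspose_same (vecMul_injective_of_isUnit g.isUnit)

end Congruence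

section Factorization

variable {ι : Type*} {n : ℕ}

theorem isHermitian_iff_isSymm {X : Matrix ι ι ℝ} : X.IsHermitian ↔ X.IsSymm := by
  rw [IsHermitian, IsSymm, conjTranspose_eq_transpose_of_trivial]

theorem isSymm_of_posDef {X : Matrix ι ι ℝ} (hX : X.PosDef) : X.IsSymm :=
  isHermitian_iff_isSymm.1 hX.isHermitian

theorem exists_antitone_diagonalization {X : Matrix (Fin n) (Fin n) ℝ} (hX : X.IsSymm) :
    ∃ (U : orthogonalGroup (Fin n) ℝ) (l : Fin n → ℝ),
      Antitone l ∧ X = congruence U.1 (diagonal l) := by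
  have hH := isHermitian_iff_isSymm.2 hX
  let V : orthogonalGroup (Fin n) ℝ := hH.eigenvectorUnitary
  let σ := Tuple.sort (-hH.eigenvalues)
  have hV : X = congruence V.1 (diagonal hH.eigenvalues) := by
    have h := hH.spectral_theorem
    rw [Unitary.conjStarAlgAut_apply] at h
    exact h
  have hVσ : V.1.submatrix id σ ∈ orthogonalGroup (Fin n) ℝ := by
    rw [mem_orthogonalGroup_iff, transpose_submatrix, submatrix_mul_equiv, submatrix_id_id]
    exact (mem_orthogonalGroup_iff _ _).1 V.2
  refine ⟨⟨_, hVσ⟩, hH.eigenvalues ∘ σ, fun i j hij =>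
    neg_le_neg_iff.1 (Tuple.monotone_sort (-hH.eigenvalues) hij), ?_⟩
  rw [congruence, transpose_submatrix, ← submatrix_diagonal_equiv, submatrix_mul_equiv,
    submatrix_mul_equiv, submatrix_id_id]
  exact hV

open scoped MatrixOrder Matrix.Norms.L2Operator in
theorem exists_eq_congruence_one [Fintype ι] [DecidableEq ι] {X : Matrix ι ι ℝ}
    (hX : X.PosDef) : ∃ g : GL ι ℝ, X = congruence g.1 1 := by
  obtain ⟨_, ⟨g, rfl⟩, hg⟩ :=
    CStarAlgebra.isStrictlyPositive_iff_eq_mul_star_self.1 (isStrictlyPositive_iff_posDef.2 hX)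
  exact ⟨g, by rw [congruence, Matrix.mul_one]; exact hg⟩

theorem exists_simultaneous_congruence {X V : Matrix (Fin n) (Fin n) ℝ} (hX : X.PosDef)
    (hV : V.IsSymm) :
    ∃ (g : GL (Fin n) ℝ) (φ : Fin n → ℝ),
      Antitone φ ∧ X = congruence g.1 1 ∧ V = congruence g.1 (diagonal φ) := by
  obtain ⟨p, rfl⟩ := exists_eq_congruence_one hX
  obtain ⟨U, φ, hφ, hU⟩ := exists_antitone_diagonalization (isSymm_congruence (p⁻¹).1 hV)
  refine ⟨p * Unitary.toUnits U, φ, hφ, ?_, ?_⟩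
  · rw [Units.val_mul, ← congruence_congruence, Unitary.val_toUnits_apply,
      congruence_orthogonal_one]
  · rw [Units.val_mul, ← congruence_congruence, Unitary.val_toUnits_apply, ← hU,
      congruence_inv_congruence]

end Factorization

section Geodesics

variable {n : ℕ}

theorem velocity_eq {c : ℝ → Matrix (Fin n) (Fin n) ℝ} {c' : Matrix (Fin n) (Fin n) ℝ} {t : ℝ}
    (h : HasDerivAt c c' t) : velocity c t = c' := by
  ext i j
  exact (hasDerivAt_matrix_iff.1 h i j).deriv

theorem hasDerivAt_velocity {c : ℝ → Matrix (Fin n) (Fin n) ℝ}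
    (hc : ∀ i j, ContDiff ℝ 1 fun t => c t i j) (t : ℝ) : HasDerivAt c (velocity c t) t :=
  hasDerivAt_matrix_iff.2 fun i j => ((hc i j).differentiable one_ne_zero t).hasDerivAt

theorem metric_eq_trace_mul (X U V : Matrix (Fin n) (Fin n) ℝ) :
    metric X U V = (X⁻¹ * U * X⁻¹ * V).trace := by
  rw [metric, trace_mul_comm]
  simp only [Matrix.mul_assoc]

theorem hasDerivAt_metric_add_smul {X : Matrix (Fin n) (Fin n) ℝ} (hX : IsUnit X)
    (U V : Matrix (Fin n) (Fin n) ℝ) :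
    HasDerivAt (fun ε : ℝ => metric (X + ε • V) U U)
      (-2 * (X⁻¹ * U * X⁻¹ * U * X⁻¹ * V).trace) 0 := by
  have hline : HasDerivAt (fun ε : ℝ => X + ε • V) V 0 := hasDerivAt_matrix_iff.2 fun i j => by
    simpa using ((hasDerivAt_id (0 : ℝ)).mul_const (V i j)).const_add (X i j)
  have hinv : HasDerivAt (fun ε : ℝ => U * (X + ε • V)⁻¹) (-(U * X⁻¹ * V * X⁻¹)) 0 := by
    convert hasDerivAt_const_mul U (hasDerivAt_inv hline (by simpa using hX)) using 1
    simp only [zero_smul, add_zero, Matrix.mul_neg, Matrix.mul_assoc]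
  have hsq : HasDerivAt (fun ε : ℝ => metric (X + ε • V) U U)
      (-(U * X⁻¹ * V * X⁻¹) * (U * X⁻¹) + U * X⁻¹ * -(U * X⁻¹ * V * X⁻¹)).trace 0 := by
    simpa only [metric, zero_smul, add_zero, Matrix.mul_assoc] using
      hasDerivAt_trace (hasDerivAt_mul hinv hinv)
  convert hsq using 1
  have hcycle : (X⁻¹ * U * X⁻¹ * U * X⁻¹ * V).trace = (U * X⁻¹ * (U * X⁻¹ * V * X⁻¹)).trace := by
    simpa only [Matrix.mul_assoc] using trace_mul_comm X⁻¹ (U * X⁻¹ * U * X⁻¹ * V)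
  rw [trace_add, Matrix.neg_mul, Matrix.mul_neg, trace_neg, trace_neg,
    trace_mul_comm (U * X⁻¹ * V * X⁻¹), hcycle]
  ring

/-- The momentum of a curve: the tangent vector `X'` at `X`, as a covector for `metric` paired
with directions by the trace. -/
def momentum (X : ℝ → Matrix (Fin n) (Fin n) ℝ) (t : ℝ) : Matrix (Fin n) (Fin n) ℝ :=
  (X t)⁻¹ * velocity X t * (X t)⁻¹

theorem hasDerivAt_iff_trace {Y : ℝ → Matrix (Fin n) (Fin n) ℝ} {Z : Matrix (Fin n) (Fin n) ℝ}
    {t : ℝ} (hY : ∀ s, (Y s).IsSymm) (hZ : Z.IsSymm) :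
    HasDerivAt Y Z t ↔ ∀ V : Matrix (Fin n) (Fin n) ℝ, V.IsSymm →
      HasDerivAt (fun s => (Y s * V).trace) (Z * V).trace t := by
  refine ⟨fun h V _ => hasDerivAt_trace (hasDerivAt_mul_const h V), fun h => ?_⟩
  refine hasDerivAt_matrix_iff.2 fun i j => ?_
  have hV : (single i j (1 : ℝ) + single j i 1).IsSymm := by
    rw [IsSymm, transpose_add, transpose_single, transpose_single, add_comm]
  have htr {M : Matrix (Fin n) (Fin n) ℝ} (hM : M.IsSymm) :
      (M * (single i j (1 : ℝ) + single j i 1)).trace = 2 * M i j := by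
    rw [Matrix.mul_add, trace_add, trace_mul_comm, trace_mul_comm M, trace_single_mul,
      trace_single_mul, hM.apply, two_mul]
    simp only [one_smul]
  have h := h _ hV
  simp only [htr hZ, htr (hY _)] at h
  simpa using h.const_mul (1 / 2 : ℝ)

theorem geodesic_eq_iff {X : ℝ → Matrix (Fin n) (Fin n) ℝ} (hX : ∀ t, (X t).PosDef)
    (hd : ∀ t, HasDerivAt X (velocity X t) t) (t : ℝ) :
    (∀ V : Matrix (Fin n) (Fin n) ℝ, V.IsSymm →
      HasDerivAt (fun s => metric (X s) (velocity X s) V)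
        ((1 / 2) * deriv (fun ε : ℝ => metric (X t + ε • V) (velocity X t) (velocity X t)) 0) t) ↔
    HasDerivAt (momentum X) (-(momentum X t * velocity X t * (X t)⁻¹)) t := by
  have hinv s : ((X s)⁻¹).IsSymm := isSymm_of_posDef (hX s).inv
  have hvel s : (velocity X s).IsSymm := isSymm_of_hasDerivAt (hd s) <|
    .of_forall fun s => isSymm_of_posDef (hX s)
  have hmom s : (momentum X s).IsSymm := by
    simp only [momentum, IsSymm, transpose_mul, (hinv s).eq, (hvel s).eq, Matrix.mul_assoc]
  have hforce : (-(momentum X t * velocity X t * (X t)⁻¹)).IsSymm := by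
    simp only [momentum, IsSymm, transpose_neg, transpose_mul, (hinv t).eq, (hvel t).eq,
      Matrix.mul_assoc]
  rw [hasDerivAt_iff_trace hmom hforce]
  refine forall₂_congr fun V _ => ?_
  simp only [metric_eq_trace_mul _ _ V, (hasDerivAt_metric_add_smul (hX t).isUnit _ V).deriv,
    Matrix.neg_mul, trace_neg, momentum]
  ring_nf

theorem forall_hasDerivAt_momentum_iff {X : ℝ → Matrix (Fin n) (Fin n) ℝ} (hX : ∀ t, (X t).PosDef)
    (hd : ∀ t, HasDerivAt X (velocity X t) t) :
    (∀ t, HasDerivAt (momentum X) (-(momentum X t * velocity X t * (X t)⁻¹)) t) ↔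
      ∃ M, ∀ t, velocity X t = X t * M := by
  have hdet t : IsUnit (X t).det := (isUnit_iff_isUnit_det _).1 (hX t).isUnit
  constructor
  · intro h
    have hconst : ∀ t, HasDerivAt (fun s => momentum X s * X s) 0 t := by
      intro t
      convert hasDerivAt_mul (h t) (hd t) using 1
      rw [Matrix.neg_mul, nonsing_inv_mul_cancel_right _ _ (hdet t), neg_add_cancel]
    refine ⟨momentum X 0 * X 0, fun t => ?_⟩
    rw [eq_of_forall_hasDerivAt_zero hconst 0 t, momentum,
      nonsing_inv_mul_cancel_right _ _ (hdet t), mul_nonsing_inv_cancel_left _ _ (hdet t)]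
  · rintro ⟨M, hM⟩ t
    have hmom s : momentum X s = M * (X s)⁻¹ := by
      rw [momentum, hM, nonsing_inv_mul_cancel_left _ _ (hdet s)]
    convert hasDerivAt_const_mul M (hasDerivAt_inv (hd t) (hX t).isUnit) using 1
    · exact funext hmom
    · rw [hmom, Matrix.mul_neg]
      simp only [Matrix.mul_assoc]

/-- The curve `g diag(e^{φ₁ t}, …, e^{φₙ t}) gᵀ`, the normal form of a geodesic. -/
def expCurve (g : GL (Fin n) ℝ) (φ : Fin n → ℝ) (t : ℝ) : Matrix (Fin n) (Fin n) ℝ :=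
  congruence g.1 (diagonal fun i => Real.exp (φ i * t))

theorem posDef_expCurve (g : GL (Fin n) ℝ) (φ : Fin n → ℝ) (t : ℝ) : (expCurve g φ t).PosDef :=
  posDef_congruence (PosDef.diagonal fun _ => Real.exp_pos _) g

theorem expCurve_zero (g : GL (Fin n) ℝ) (φ : Fin n → ℝ) : expCurve g φ 0 = congruence g.1 1 := by
  simp [expCurve]

theorem expCurve_apply (g : GL (Fin n) ℝ) (φ : Fin n → ℝ) (t : ℝ) (i j : Fin n) :
    expCurve g φ t i j = ∑ k, g.1 i k * Real.exp (φ k * t) * g.1 j k := by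
  simp only [expCurve, congruence, mul_apply (N := g.1ᵀ), mul_diagonal, transpose_apply]

theorem contDiff_expCurve {m : WithTop ℕ∞} (g : GL (Fin n) ℝ) (φ : Fin n → ℝ) (i j : Fin n) :
    ContDiff ℝ m fun t => expCurve g φ t i j := by
  simp only [expCurve_apply]
  fun_prop

theorem hasDerivAt_diagonal_exp (φ : Fin n → ℝ) (t : ℝ) :
    HasDerivAt (fun t => diagonal fun i => Real.exp (φ i * t))
      ((diagonal fun i => Real.exp (φ i * t)) * diagonal φ) t := by
  refine hasDerivAt_matrix_iff.2 fun i j => ?_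
  rw [diagonal_mul_diagonal]
  rcases eq_or_ne i j with rfl | hij
  · simpa using ((hasDerivAt_id t).const_mul (φ i)).exp
  · simpa only [diagonal_apply_ne _ hij] using hasDerivAt_const t (0 : ℝ)

theorem hasDerivAt_expCurve (g : GL (Fin n) ℝ) (φ : Fin n → ℝ) (t : ℝ) :
    HasDerivAt (expCurve g φ) (expCurve g φ t * ((g⁻¹).1ᵀ * diagonal φ * g.1ᵀ)) t := by
  rw [expCurve, congruence_mul]
  exact hasDerivAt_mul_const (hasDerivAt_const_mul g.1 (hasDerivAt_diagonal_exp φ t)) g.1ᵀ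

theorem exists_paramGeodesic (g : GL (Fin n) ℝ) {φ : Fin n → ℝ} (hφ : φ ≠ 0) :
    ∃ μ : ParamGeodesic n, μ.toFun = expCurve g φ := by
  have hd t : HasDerivAt (expCurve g φ) (velocity (expCurve g φ) t) t :=
    hasDerivAt_velocity (contDiff_expCurve g φ) t
  have hgeod := (forall_hasDerivAt_momentum_iff (posDef_expCurve g φ) hd).2
    ⟨_, fun t => velocity_eq (hasDerivAt_expCurve g φ t)⟩
  refine ⟨⟨expCurve g φ, posDef_expCurve g φ, contDiff_expCurve g φ,
    fun V hV t => (geodesic_eq_iff (posDef_expCurve g φ) hd t).2 (hgeod t) V hV, 1, 0,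
    fun h => hφ ?_⟩, rfl⟩
  have hexp := congrArg (congruence (g⁻¹).1) h
  simp only [expCurve, inv_congruence_congruence, mul_one, mul_zero, Real.exp_zero] at hexp
  exact funext fun i => by simpa using congrFun (diagonal_injective hexp) i

theorem ParamGeodesic.exists_eq_expCurve (μ : ParamGeodesic n) :
    ∃ (g : GL (Fin n) ℝ) (φ : Fin n → ℝ), Antitone φ ∧ φ ≠ 0 ∧ μ.toFun = expCurve g φ := by
  have hd : ∀ t, HasDerivAt μ.toFun (velocity μ.toFun t) t :=
    hasDerivAt_velocity fun i j => (μ.smooth i j).of_le one_le_two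
  obtain ⟨M, hM⟩ := (forall_hasDerivAt_momentum_iff μ.posDef hd).1 fun t =>
    (geodesic_eq_iff μ.posDef hd t).1 fun V hV => μ.geodesic_eq V hV t
  obtain ⟨g, φ, hφ, hpoint, hvel⟩ := exists_simultaneous_congruence (μ.posDef 0)
    (isSymm_of_hasDerivAt (hd 0) <| .of_forall fun s => isSymm_of_posDef (μ.posDef s))
  have hexp : ∀ t, HasDerivAt (expCurve g φ) (expCurve g φ t * M) t := by
    intro t
    have hM0 : M = (g⁻¹).1ᵀ * diagonal φ * g.1ᵀ := by
      apply (μ.posDef 0).isUnit.mul_left_cancel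
      rw [← hM, hvel, hpoint, congruence_mul, Matrix.one_mul]
    rw [hM0]
    exact hasDerivAt_expCurve g φ t
  have heq : μ.toFun = expCurve g φ :=
    eq_of_hasDerivAt_mul (fun t => hM t ▸ hd t) hexp (fun t => (posDef_expCurve g φ t).isUnit)
      (hpoint.trans (expCurve_zero g φ).symm)
  refine ⟨g, φ, hφ, fun h0 => ?_, heq⟩
  obtain ⟨s, t, hst⟩ := μ.nonconst
  exact hst (by simp only [heq, h0, expCurve, Pi.zero_apply, zero_mul])

end Geodesics

section QuadForm

variable {n : ℕ}

theorem quadForm_eq (X : Matrix (Fin n) (Fin n) ℝ) (v : Fin n → ℝ) :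
    quadForm X v = 1 / 2 * (v ⬝ᵥ X *ᵥ v) := by
  simp only [quadForm, dotProduct, mulVec, Finset.mul_sum]
  exact Finset.sum_congr rfl fun i _ => Finset.sum_congr rfl fun j _ => by ring

theorem quadForm_congruence (g X : Matrix (Fin n) (Fin n) ℝ) (v : Fin n → ℝ) :
    quadForm (congruence g X) v = quadForm X (gᵀ *ᵥ v) := by
  rw [quadForm_eq, quadForm_eq, congruence, ← mulVec_mulVec, ← mulVec_mulVec, dotProduct_mulVec,
    ← mulVec_transpose]

theorem quadForm_diagonal (d v : Fin n → ℝ) :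
    quadForm (diagonal d) v = 1 / 2 * ∑ i, d i * v i ^ 2 := by
  rw [quadForm_eq, dotProduct]
  exact congrArg _ (Finset.sum_congr rfl fun i _ => by rw [mulVec_diagonal]; ring)

theorem quadForm_one (v : Fin n → ℝ) : quadForm 1 v = 1 / 2 * ∑ i, v i ^ 2 := by
  simp only [← diagonal_one, quadForm_diagonal, one_mul]

theorem quadForm_pos {X : Matrix (Fin n) (Fin n) ℝ} (hX : X.PosDef) {v : Fin n → ℝ} (hv : v ≠ 0) :
    0 < quadForm X v := by
  rw [quadForm_eq]
  exact mul_pos one_half_pos (by simpa only [star_trivial] using hX.dotProduct_mulVec_pos hv)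

theorem hasDerivAt_quadForm {X : ℝ → Matrix (Fin n) (Fin n) ℝ} {X' : Matrix (Fin n) (Fin n) ℝ}
    {t : ℝ} (hX : HasDerivAt X X' t) (v : Fin n → ℝ) :
    HasDerivAt (fun s => quadForm (X s) v) (quadForm X' v) t :=
  (HasDerivAt.fun_sum fun i _ => HasDerivAt.fun_sum fun j _ =>
    ((hasDerivAt_matrix_iff.1 hX i j).mul_const (v i)).mul_const (v j)).const_mul _

end QuadForm

section Metric

variable {n : ℕ}

theorem metric_congruence (g : GL (Fin n) ℝ) (X U V : Matrix (Fin n) (Fin n) ℝ) :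
    metric (congruence g.1 X) (congruence g.1 U) (congruence g.1 V) = metric X U V := by
  have hdet : IsUnit g.1ᵀ.det := (isUnit_iff_isUnit_det _).1 ((isUnit_transpose _).2 g.isUnit)
  have hmul (A : Matrix (Fin n) (Fin n) ℝ) :
      congruence g.1 A * (congruence g.1 X)⁻¹ = g.1 * (A * X⁻¹) * (g⁻¹).1 := by
    rw [congruence, congruence, Matrix.mul_inv_rev, Matrix.mul_inv_rev, coe_units_inv]
    simp only [Matrix.mul_assoc, mul_nonsing_inv_cancel_left _ _ hdet]
  have hconj (A B : Matrix (Fin n) (Fin n) ℝ) :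
      g.1 * A * (g⁻¹).1 * (g.1 * B * (g⁻¹).1) = g.1 * (A * B) * (g⁻¹).1 := by
    simp only [Matrix.mul_assoc, Units.inv_mul_cancel_left]
  rw [metric, Matrix.mul_assoc, hmul, hmul, hconj, trace_units_conj, metric, ← Matrix.mul_assoc]

theorem metric_mul_mul {X : Matrix (Fin n) (Fin n) ℝ} (hX : IsUnit X)
    (M N : Matrix (Fin n) (Fin n) ℝ) : metric X (X * M) (X * N) = (M * N).trace := by
  have hdet := (isUnit_iff_isUnit_det _).1 hX
  rw [metric_eq_trace_mul, nonsing_inv_mul_cancel_left _ _ hdet, ← Matrix.mul_assoc,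
    nonsing_inv_mul_cancel_right _ _ hdet]

theorem metric_one_diagonal (φ : Fin n → ℝ) :
    metric 1 (diagonal φ) (diagonal φ) = ∑ i, φ i ^ 2 := by
  simp [metric, sq]

theorem metric_velocity_expCurve (g : GL (Fin n) ℝ) (φ : Fin n → ℝ) (t : ℝ) :
    metric (expCurve g φ t) (velocity (expCurve g φ) t) (velocity (expCurve g φ) t) =
      ∑ i, φ i ^ 2 := by
  have hE : IsUnit (diagonal fun i => Real.exp (φ i * t)) :=
    (PosDef.diagonal fun _ => Real.exp_pos _).isUnit
  rw [velocity_eq (hasDerivAt_expCurve g φ t), expCurve, congruence_mul, metric_congruence,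
    metric_mul_mul hE, diagonal_mul_diagonal, trace_diagonal]
  simp only [sq]

theorem abs_le_sqrt_sum_sq {ι : Type*} [Fintype ι] (x : ι → ℝ) (i : ι) : |x i| ≤ √(∑ j, x j ^ 2) :=
  Real.abs_le_sqrt (Finset.single_le_sum (fun j _ => sq_nonneg (x j)) (Finset.mem_univ i))

theorem abs_quadForm_le {X V : Matrix (Fin n) (Fin n) ℝ} (hX : X.PosDef) (hV : V.IsSymm)
    (v : Fin n → ℝ) : |quadForm V v| ≤ √(metric X V V) * quadForm X v := by
  obtain ⟨g, φ, -, rfl, rfl⟩ := exists_simultaneous_congruence hX hV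
  rw [metric_congruence, metric_one_diagonal, quadForm_congruence, quadForm_congruence,
    quadForm_diagonal, quadForm_one, abs_mul, abs_of_pos one_half_pos, mul_left_comm,
    Finset.mul_sum]
  refine mul_le_mul_of_nonneg_left (Finset.abs_sum_le_sum_abs _ _ |>.trans ?_) one_half_pos.le
  refine Finset.sum_le_sum fun i _ => ?_
  rw [abs_mul, abs_sq]
  have hφ := abs_le_sqrt_sum_sq φ i
  gcongr

end Metric

section Distance

variable {n : ℕ} {X Y : Matrix (Fin n) (Fin n) ℝ}

theorem length_nonneg (c : ℝ → Matrix (Fin n) (Fin n) ℝ) : 0 ≤ length c :=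
  intervalIntegral.integral_nonneg zero_le_one fun _ _ => Real.sqrt_nonneg _

theorem rho_nonneg (X Y : Matrix (Fin n) (Fin n) ℝ) : 0 ≤ rho X Y := by
  refine Real.sInf_nonneg ?_
  rintro _ ⟨c, -, rfl⟩
  exact length_nonneg c

theorem rho_le_length {c : ℝ → Matrix (Fin n) (Fin n) ℝ} (hc : IsPath X Y c) :
    rho X Y ≤ length c := by
  refine csInf_le ⟨0, ?_⟩ ⟨c, hc, rfl⟩
  rintro _ ⟨c, -, rfl⟩
  exact length_nonneg c

theorem rho_self (hX : X.PosDef) : rho X X = 0 := by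
  refine le_antisymm ((rho_le_length (c := fun _ => X)
    ⟨fun _ _ => contDiff_const, fun _ _ => hX, rfl, rfl⟩).trans_eq ?_) (rho_nonneg _ _)
  have hv t : velocity (fun _ : ℝ => X) t = 0 :=
    velocity_eq (hasDerivAt_matrix_iff.2 fun i j => hasDerivAt_const t (X i j))
  simp [length, hv, metric]

theorem IsPath.congruence {c : ℝ → Matrix (Fin n) (Fin n) ℝ} (hc : IsPath X Y c)
    (g : GL (Fin n) ℝ) :
    IsPath (congruence g.1 X) (congruence g.1 Y) fun t => congruence g.1 (c t) where
  smooth i j := by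
    have := hc.smooth
    simp only [PosDefSpace.congruence, mul_apply]
    fun_prop
  posDef t ht := posDef_congruence (hc.posDef t ht) g
  source := by rw [hc.source]
  target := by rw [hc.target]

theorem IsPath.length_congruence {c : ℝ → Matrix (Fin n) (Fin n) ℝ} (hc : IsPath X Y c)
    (g : GL (Fin n) ℝ) : length (fun t => PosDefSpace.congruence g.1 (c t)) = length c := by
  have hvel t : velocity (fun t => PosDefSpace.congruence g.1 (c t)) t =
      PosDefSpace.congruence g.1 (velocity c t) :=
    velocity_eq (hasDerivAt_mul_const (hasDerivAt_const_mul g.1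
      (hasDerivAt_velocity hc.smooth t)) g.1ᵀ)
  simp only [length, hvel, metric_congruence]

theorem rho_congruence (g : GL (Fin n) ℝ) (X Y : Matrix (Fin n) (Fin n) ℝ) :
    rho (congruence g.1 X) (congruence g.1 Y) = rho X Y := by
  refine congrArg sInf (Set.ext fun L => ⟨?_, ?_⟩)
  · rintro ⟨c, hc, rfl⟩
    have hc' := hc.congruence g⁻¹
    rw [inv_congruence_congruence, inv_congruence_congruence] at hc'
    exact ⟨_, hc', (hc.length_congruence g⁻¹).symm⟩
  · rintro ⟨c, hc, rfl⟩
    exact ⟨_, hc.congruence g, (hc.length_congruence g).symm⟩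

theorem isPath_expCurve_log (g : GL (Fin n) ℝ) {l : Fin n → ℝ} (hl : ∀ i, 0 < l i) :
    IsPath (congruence g.1 1) (congruence g.1 (diagonal l))
      (expCurve g fun i => Real.log (l i)) where
  smooth := contDiff_expCurve _ _
  posDef t _ := posDef_expCurve _ _ t
  source := expCurve_zero _ _
  target := by simp only [expCurve, mul_one, Real.exp_log (hl _)]

theorem pos_of_posDef_congruence_diagonal {g : GL (Fin n) ℝ} {l : Fin n → ℝ}
    (h : (congruence g.1 (diagonal l)).PosDef) (i : Fin n) : 0 < l i := by
  have hl := posDef_congruence h g⁻¹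
  rw [inv_congruence_congruence] at hl
  exact posDef_diagonal_iff.1 hl i

theorem exists_isPath (hX : X.PosDef) (hY : Y.PosDef) : ∃ c, IsPath X Y c := by
  obtain ⟨g, l, -, rfl, rfl⟩ := exists_simultaneous_congruence hX (isSymm_of_posDef hY)
  exact ⟨_, isPath_expCurve_log g (pos_of_posDef_congruence_diagonal hY)⟩

theorem rho_congruence_one_diagonal_le (g : GL (Fin n) ℝ) {l : Fin n → ℝ} (hl : ∀ i, 0 < l i) :
    rho (congruence g.1 1) (congruence g.1 (diagonal l)) ≤ √(∑ i, Real.log (l i) ^ 2) := by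
  refine (rho_le_length (isPath_expCurve_log g hl)).trans_eq ?_
  simp only [length, metric_velocity_expCurve]
  simp

theorem tendsto_rho_one {α : Type*} {𝓁 : Filter α} {Y : α → Matrix (Fin n) (Fin n) ℝ}
    (hY : ∀ a, (Y a).PosDef) (h : Tendsto Y 𝓁 (𝓝 1)) : Tendsto (fun a => rho 1 (Y a)) 𝓁 (𝓝 0) := by
  choose U l _ hl using fun a => exists_antitone_diagonalization (isSymm_of_posDef (hY a))
  have hU a : congruence (Unitary.toUnits (U a)).1 1 = 1 := congruence_orthogonal_one (U a)
  have hYl a : Y a = congruence (Unitary.toUnits (U a)).1 (diagonal (l a)) := hl a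
  have hpos a := pos_of_posDef_congruence_diagonal (hYl a ▸ hY a)
  have hfrob a : ∑ i, (l a i - 1) ^ 2 = metric 1 (Y a - 1) (Y a - 1) := by
    have hsub : Y a - 1 = congruence (Unitary.toUnits (U a)).1 (diagonal (l a) - 1) := by
      rw [congruence_sub, ← hYl, hU]
    rw [hsub, ← congrArg (metric · _ _) (hU a), metric_congruence, ← diagonal_one, diagonal_sub,
      diagonal_one, metric_one_diagonal]
  have hsum : Tendsto (fun a => ∑ i, (l a i - 1) ^ 2) 𝓁 (𝓝 0) := by
    have hcont : Continuous fun Z : Matrix (Fin n) (Fin n) ℝ => metric 1 (Z - 1) (Z - 1) := by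
      simp only [metric]
      fun_prop
    simpa only [hfrob, Function.comp_def, sub_self, metric, Matrix.zero_mul, trace_zero] using
      (hcont.tendsto 1).comp h
  have hl1 i : Tendsto (fun a => l a i) 𝓁 (𝓝 1) := by
    have hdiff : Tendsto (fun a => l a i - 1) 𝓁 (𝓝 0) :=
      squeeze_zero_norm (fun a => abs_le_sqrt_sum_sq (fun i => l a i - 1) i)
        (by simpa using hsum.sqrt)
    simpa using hdiff.add_const 1
  refine squeeze_zero (fun a => rho_nonneg _ _) (fun a => ?_)
    (?_ : Tendsto (fun a => √(∑ i, Real.log (l a i) ^ 2)) 𝓁 (𝓝 0))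
  · conv_lhs => rw [hYl a, ← hU a]
    exact rho_congruence_one_diagonal_le _ (hpos a)
  · simpa using (tendsto_finsetSum Finset.univ fun i _ =>
      ((hl1 i).log one_ne_zero).pow 2).sqrt

theorem IsPath.continuousOn_speed {c : ℝ → Matrix (Fin n) (Fin n) ℝ} (hc : IsPath X Y c) :
    ContinuousOn (fun t => √(metric (c t) (velocity c t) (velocity c t))) (Set.Icc 0 1) := by
  have hv : Continuous (velocity c) := continuous_matrix fun i j =>
    (hc.smooth i j).continuous_deriv_one
  have hcont : Continuous c := continuous_matrix fun i j => (hc.smooth i j).continuous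
  have hinv : ContinuousOn (fun t => (c t)⁻¹) (Set.Icc 0 1) := fun t ht =>
    (tendsto_inv (hc.posDef t ht).isUnit (hcont.tendsto t)).mono_left nhdsWithin_le_nhds
  exact (continuous_id.matrix_trace.comp_continuousOn
    (((hv.continuousOn.mul hinv).mul hv.continuousOn).mul hinv)).sqrt

theorem IsPath.abs_deriv_log_quadForm_le {c : ℝ → Matrix (Fin n) (Fin n) ℝ} (hc : IsPath X Y c)
    {v : Fin n → ℝ} (hv : v ≠ 0) {t : ℝ} (ht : t ∈ Set.Ioo (0 : ℝ) 1) :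
    |deriv (fun s => Real.log (quadForm (c s) v)) t| ≤
      √(metric (c t) (velocity c t) (velocity c t)) := by
  have hd := hasDerivAt_velocity hc.smooth t
  have hX := hc.posDef t (Set.Ioo_subset_Icc_self ht)
  have hsymm : (velocity c t).IsSymm := isSymm_of_hasDerivAt hd <| by
    filter_upwards [Ioo_mem_nhds ht.1 ht.2] with s hs
    exact isSymm_of_posDef (hc.posDef s (Set.Ioo_subset_Icc_self hs))
  have hpos := quadForm_pos hX hv
  rw [((hasDerivAt_quadForm hd v).log hpos.ne').deriv, abs_div, abs_of_pos hpos, div_le_iff₀ hpos]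
  exact abs_quadForm_le hX hsymm v

theorem IsPath.abs_log_quadForm_sub_le {c : ℝ → Matrix (Fin n) (Fin n) ℝ} (hc : IsPath X Y c)
    {v : Fin n → ℝ} (hv : v ≠ 0) :
    |Real.log (quadForm Y v) - Real.log (quadForm X v)| ≤ length c := by
  have hdiff : ∀ t ∈ Set.Icc (0 : ℝ) 1,
      DifferentiableAt ℝ (fun s => Real.log (quadForm (c s) v)) t := fun t ht =>
    ((hasDerivAt_quadForm (hasDerivAt_velocity hc.smooth t) v).log
      (quadForm_pos (hc.posDef t ht) hv).ne').differentiableAt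
  have h := norm_sub_le_integral_of_norm_deriv_le_of_le zero_le_one
    (fun t ht => (hdiff t ht).continuousAt.continuousWithinAt)
    (fun t ht => (hdiff t (Set.Ioo_subset_Icc_self ht)).differentiableWithinAt)
    (Eventually.of_forall fun t ht => hc.abs_deriv_log_quadForm_le hv ht)
    (hc.continuousOn_speed.intervalIntegrable_of_Icc zero_le_one)
  rwa [hc.source, hc.target, Real.norm_eq_abs] at h

theorem abs_log_quadForm_sub_le_rho (hX : X.PosDef) (hY : Y.PosDef) {v : Fin n → ℝ} (hv : v ≠ 0) :
    |Real.log (quadForm Y v) - Real.log (quadForm X v)| ≤ rho X Y := by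
  obtain ⟨c, hc⟩ := exists_isPath hX hY
  refine le_csInf ⟨_, c, hc, rfl⟩ ?_
  rintro _ ⟨d, hd, rfl⟩
  exact hd.abs_log_quadForm_sub_le hv

end Distance

section NullAsymptotic

variable {n : ℕ} {μ ν : ParamGeodesic n}

theorem distForward_nonneg (X : Matrix (Fin n) (Fin n) ℝ) (ν : ParamGeodesic n) (S : ℝ) :
    0 ≤ distForward X ν S := by
  refine Real.sInf_nonneg ?_
  rintro _ ⟨s, -, rfl⟩
  exact rho_nonneg _ _

theorem distForward_le (X : Matrix (Fin n) (Fin n) ℝ) (ν : ParamGeodesic n) {S s : ℝ}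
    (hs : S ≤ s) : distForward X ν S ≤ rho X (ν.toFun s) := by
  refine csInf_le ⟨0, ?_⟩ ⟨s, hs, rfl⟩
  rintro _ ⟨s, -, rfl⟩
  exact rho_nonneg _ _

theorem nullAsymptotic_of_tendsto {s : ℝ → ℝ} (hs : Tendsto s atTop atTop)
    (h : Tendsto (fun t => rho (μ.toFun t) (ν.toFun (s t))) atTop (𝓝 0)) : NullAsymptotic μ ν := by
  intro S
  refine squeeze_zero' (Eventually.of_forall fun t => distForward_nonneg _ _ _) ?_ h
  filter_upwards [hs.eventually_ge_atTop S] with t ht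
  exact distForward_le _ _ ht

theorem NullAsymptotic.exists_seq (h : NullAsymptotic μ ν) :
    ∃ t s : ℕ → ℝ, Tendsto t atTop atTop ∧ Tendsto s atTop atTop ∧
      Tendsto (fun N => rho (μ.toFun (t N)) (ν.toFun (s N))) atTop (𝓝 0) := by
  have hclose (N : ℕ) : ∃ t s : ℝ, (N : ℝ) ≤ t ∧ (N : ℝ) ≤ s ∧
      rho (μ.toFun t) (ν.toFun s) < 1 / ((N : ℝ) + 1) := by
    obtain ⟨t, hdist, ht⟩ := (((h N).eventually_lt_const (Nat.one_div_pos_of_nat (n := N))).and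
      (eventually_ge_atTop (N : ℝ))).exists
    obtain ⟨_, ⟨s, hs, rfl⟩, hlt⟩ := exists_lt_of_csInf_lt (s := {d | ∃ s, (N : ℝ) ≤ s ∧
      d = rho (μ.toFun t) (ν.toFun s)}) ⟨_, (N : ℝ), le_rfl, rfl⟩ hdist
    exact ⟨t, s, ht, hs, hlt⟩
  choose t s ht hs hts using hclose
  exact ⟨t, s, tendsto_atTop_mono ht tendsto_natCast_atTop_atTop,
    tendsto_atTop_mono hs tendsto_natCast_atTop_atTop,
    squeeze_zero (fun N => rho_nonneg _ _) (fun N => (hts N).le)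
      tendsto_one_div_add_atTop_nhds_zero_nat⟩

end NullAsymptotic

section Blocks

variable {n : ℕ} (I : CompositionAsSet n)

theorem cut_strictMono : StrictMono (cut I) :=
  (I.boundaries.orderEmbOfFin I.card_boundaries_eq_succ_length).strictMono

theorem mem_boundaries_iff {j : Fin (n + 1)} : j ∈ I.boundaries ↔ ∃ k, cut I k = j := by
  rw [← Finset.mem_coe, ← Finset.range_orderEmbOfFin I.boundaries I.card_boundaries_eq_succ_length]
  rfl

theorem cut_zero : cut I 0 = 0 := by
  obtain ⟨k, hk⟩ := (mem_boundaries_iff I).1 I.zero_mem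
  exact le_antisymm (hk ▸ (cut_strictMono I).monotone (Fin.zero_le k)) (Fin.zero_le _)

theorem cut_last : cut I (Fin.last _) = Fin.last n := by
  obtain ⟨k, hk⟩ := (mem_boundaries_iff I).1 I.getLast_mem
  exact le_antisymm (Fin.le_last _) (hk ▸ (cut_strictMono I).monotone (Fin.le_last k))

theorem exists_cut_le_lt (i : Fin n) :
    ∃ k : Fin I.length, (cut I k.castSucc : ℕ) ≤ i ∧ (i : ℕ) < cut I k.succ := by
  by_contra! h
  have hle (k : Fin (I.length + 1)) : (cut I k : ℕ) ≤ i :=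
    Fin.induction (by simp [cut_zero]) h k
  exact i.2.not_ge (by simpa [cut_last] using hle (Fin.last _))

/-- The block of a position `i`: the index `k` with `i_k ≤ i < i_{k+1}`, for positions counted
from `0`. -/
def block (i : Fin n) : Fin I.length := (exists_cut_le_lt I i).choose

theorem cut_block_le (i : Fin n) : (cut I (block I i).castSucc : ℕ) ≤ i :=
  (exists_cut_le_lt I i).choose_spec.1

theorem lt_cut_succ_block (i : Fin n) : (i : ℕ) < cut I (block I i).succ :=
  (exists_cut_le_lt I i).choose_spec.2

theorem lt_cut_iff (i : Fin n) (k : Fin (I.length + 1)) :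
    (i : ℕ) < cut I k ↔ (block I i).castSucc < k := by
  refine ⟨fun h => (cut_strictMono I).lt_iff_lt.1 ((cut_block_le I i).trans_lt h), fun h => ?_⟩
  exact (lt_cut_succ_block I i).trans_le
    ((cut_strictMono I).monotone (Fin.castSucc_lt_iff_succ_le.1 h))

theorem block_eq_iff (i : Fin n) (k : Fin I.length) :
    block I i = k ↔ (cut I k.castSucc : ℕ) ≤ i ∧ (i : ℕ) < cut I k.succ := by
  rw [← not_lt, lt_cut_iff, lt_cut_iff, Fin.castSucc_lt_castSucc_iff, Fin.castSucc_lt_succ_iff,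
    not_lt, and_comm]
  exact le_antisymm_iff

theorem block_lt_block_iff (i i' : Fin n) :
    block I i < block I i' ↔ ∃ j ∈ I.boundaries, (i : ℕ) < j ∧ (j : ℕ) ≤ i' := by
  constructor
  · intro h
    exact ⟨_, (mem_boundaries_iff I).2 ⟨(block I i').castSucc, rfl⟩,
      (lt_cut_iff I i _).2 (Fin.castSucc_lt_castSucc_iff.2 h), cut_block_le I i'⟩
  · rintro ⟨_, hj, hij, hji'⟩
    obtain ⟨k, rfl⟩ := (mem_boundaries_iff I).1 hj
    have hk : k ≤ (block I i').castSucc := not_lt.1 fun h => hji'.not_gt ((lt_cut_iff I i' k).2 h)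
    exact Fin.castSucc_lt_castSucc_iff.1 (((lt_cut_iff I i k).1 hij).trans_le hk)

theorem block_mono : Monotone (block I) := by
  intro i i' hii'
  by_contra! h
  obtain ⟨j, -, hij, hji⟩ := (block_lt_block_iff I i' i).1 h
  exact (hij.trans_le hji).not_ge hii'

theorem card_block_lt (k : Fin (I.length + 1)) :
    (Finset.univ.filter fun i : Fin n => (block I i).castSucc < k).card = cut I k := by
  simp only [← lt_cut_iff]
  rw [Fin.card_filter_val_lt]
  exact min_eq_right (Fin.is_le _)

theorem card_block_eq (k : Fin I.length) :
    (Finset.univ.filter fun i : Fin n => block I i = k).card + (cut I k.castSucc : ℕ) =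
      cut I k.succ := by
  rw [← card_block_lt, ← card_block_lt, add_comm, ← Finset.card_union_of_disjoint]
  · congr 1
    ext i
    simp only [Finset.mem_union, Finset.mem_filter, Finset.mem_univ, true_and,
      Fin.castSucc_lt_castSucc_iff, Fin.castSucc_lt_succ_iff]
    exact le_iff_lt_or_eq.symm
  · rw [Finset.disjoint_filter]
    rintro i - h rfl
    exact lt_irrefl _ h

theorem block_surjective : Function.Surjective (block I) := by
  intro k
  have hlt : (cut I k.castSucc : ℕ) < cut I k.succ := cut_strictMono I Fin.castSucc_lt_succ
  exact ⟨⟨cut I k.castSucc, hlt.trans_le (Fin.is_le _)⟩, (block_eq_iff I _ k).2 ⟨le_rfl, hlt⟩⟩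

theorem hasVelocity_iff (μ : ParamGeodesic n) (ψ : Speeds I) :
    HasVelocity μ I ψ ↔ ∃ g : GL (Fin n) ℝ, μ.toFun = expCurve g fun i => ψ.1 (block I i) := by
  constructor
  · rintro ⟨φ, hφ, g, hg⟩
    obtain rfl : φ = fun i => ψ.1 (block I i) :=
      funext fun i => hφ _ i (cut_block_le I i) (lt_cut_succ_block I i)
    exact ⟨g, funext hg⟩
  · rintro ⟨g, hg⟩
    refine ⟨fun i => ψ.1 (block I i), fun k i h1 h2 => ?_, g, congrFun hg⟩
    exact congrArg ψ.1 ((block_eq_iff I i k).2 ⟨h1, h2⟩)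

/-- The subset of `{0, …, n}` that cuts a decreasing sequence `φ` into its level sets. -/
def descents (φ : Fin n → ℝ) : CompositionAsSet n where
  boundaries := Finset.univ.filter fun j : Fin (n + 1) =>
    ∀ i i' : Fin n, (i : ℕ) < j → (j : ℕ) ≤ i' → φ i' < φ i
  zero_mem := by simp
  getLast_mem := by
    simp only [Finset.mem_filter, Finset.mem_univ, true_and, Fin.val_last]
    exact fun _ i' _ h => absurd i'.2 h.not_gt

theorem mem_descents_boundaries {φ : Fin n → ℝ} {j : Fin (n + 1)} :
    j ∈ (descents φ).boundaries ↔ ∀ i i' : Fin n, (i : ℕ) < j → (j : ℕ) ≤ i' → φ i' < φ i := by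
  simp [descents]

theorem block_descents_lt_iff {φ : Fin n → ℝ} (hφ : Antitone φ) (i i' : Fin n) :
    block (descents φ) i < block (descents φ) i' ↔ φ i' < φ i := by
  rw [block_lt_block_iff]
  constructor
  · rintro ⟨j, hj, hij, hji'⟩
    exact mem_descents_boundaries.1 hj i i' hij hji'
  · intro h
    -- The first position with a value below `φ i` starts a block.
    obtain ⟨j, hji', hj⟩ := exists_minimal_le_of_wellFoundedLT (fun l => φ l < φ i) i' h
    refine ⟨j.castSucc, mem_descents_boundaries.2 fun a b ha hb => ?_, ?_, hji'⟩
    · have hia : φ i ≤ φ a := not_lt.1 fun hlt => hj.not_prop_of_lt ha hlt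
      exact (hφ hb).trans_lt (hj.prop.trans_le hia)
    · exact not_le.1 fun hji => (hφ hji).not_gt hj.prop

theorem exists_speeds {φ : Fin n → ℝ} (hφ : Antitone φ) (h0 : φ ≠ 0) :
    ∃ (I : CompositionAsSet n) (ψ : Speeds I), φ = fun i => ψ.1 (block I i) := by
  choose r hr using block_surjective (descents φ)
  have hφr (i : Fin n) : φ i = φ (r (block (descents φ) i)) :=
    le_antisymm (not_lt.1 ((block_descents_lt_iff hφ _ _).not.1 (by simp [hr])))
      (not_lt.1 ((block_descents_lt_iff hφ _ _).not.1 (by simp [hr])))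
  refine ⟨descents φ, ⟨fun k => φ (r k), fun k l hkl => ?_, fun h => ?_⟩, funext hφr⟩
  · exact (block_descents_lt_iff hφ _ _).1 (by rwa [hr, hr])
  · exact h0 (funext fun i => (hφr i).trans (congrFun h _))

end Blocks

section CoordKer

variable {ι : Type*} [Fintype ι]

/-- The subspace of vectors on which the linear forms given by the rows of `A` with index in `p`
vanish. -/
def coordKer (A : Matrix ι ι ℝ) (p : ι → Prop) : Submodule ℝ (ι → ℝ) :=
  LinearMap.ker ((LinearMap.funLeft ℝ ℝ (Subtype.val : {i // p i} → ι)).comp A.mulVecLin)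

theorem mem_coordKer {A : Matrix ι ι ℝ} {p : ι → Prop} {v : ι → ℝ} :
    v ∈ coordKer A p ↔ ∀ i, p i → (A *ᵥ v) i = 0 := by
  rw [coordKer, LinearMap.mem_ker, funext_iff]
  exact Subtype.forall

theorem finrank_coordKer [DecidableEq ι] {A : Matrix ι ι ℝ} (hA : IsUnit A) (p : ι → Prop)
    [DecidablePred p] :
    Module.finrank ℝ (coordKer A p) + (Finset.univ.filter p).card = Fintype.card ι := by
  have hsurj : Function.Surjective
      ((LinearMap.funLeft ℝ ℝ (Subtype.val : {i // p i} → ι)).comp A.mulVecLin) := by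
    rw [LinearMap.coe_comp]
    exact (LinearMap.funLeft_surjective_of_injective ℝ ℝ _ Subtype.val_injective).comp
      (mulVec_surjective_iff_isUnit.2 hA)
  have h := LinearMap.finrank_range_add_finrank_ker
    ((LinearMap.funLeft ℝ ℝ (Subtype.val : {i // p i} → ι)).comp A.mulVecLin)
  rw [LinearMap.range_eq_top.2 hsurj, finrank_top, Module.finrank_fintype_fun_eq_card,
    Module.finrank_fintype_fun_eq_card, Fintype.card_subtype] at h
  rw [add_comm]
  exact h

theorem exists_ne_zero_of_card_add_card_lt [DecidableEq ι] {A B : Matrix ι ι ℝ} {p q : ι → Prop}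
    [DecidablePred p] [DecidablePred q] (hA : IsUnit A) (hB : IsUnit B)
    (h : (Finset.univ.filter p).card + (Finset.univ.filter q).card < Fintype.card ι) :
    ∃ v : ι → ℝ, v ≠ 0 ∧ (∀ i, p i → (A *ᵥ v) i = 0) ∧ ∀ i, q i → (B *ᵥ v) i = 0 := by
  have hp := finrank_coordKer hA p
  have hq := finrank_coordKer hB q
  have hsum := Submodule.finrank_sup_add_finrank_inf_eq (coordKer A p) (coordKer B q)
  have hsup := Submodule.finrank_le (coordKer A p ⊔ coordKer B q)
  rw [Module.finrank_fintype_fun_eq_card] at hsup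
  have hpos : 0 < Module.finrank ℝ ↥(coordKer A p ⊓ coordKer B q) := by omega
  obtain ⟨⟨v, hv⟩, hne⟩ := Module.finrank_pos_iff_exists_ne_zero.1 hpos
  exact ⟨v, fun h => hne (Subtype.ext h), mem_coordKer.1 hv.1, mem_coordKer.1 hv.2⟩

end CoordKer

section Flags

variable {n : ℕ} {I : CompositionAsSet n}

theorem Flag.mk_eq_zero_iff (W : Flag I) {k : Fin I.length} (v : W.1 k.castSucc) :
    (Submodule.Quotient.mk v : W.Subquot k) = 0 ↔ (v : Fin n → ℝ) ∈ W.1 k.succ :=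
  (Submodule.Quotient.mk_eq_zero _).trans Iff.rfl

theorem Flag.zero_eq_top (W : Flag I) : W.1 0 = ⊤ :=
  Submodule.eq_top_of_finrank_eq (by simpa [cut_zero] using W.2.2 0)

theorem Flag.last_eq_bot (W : Flag I) : W.1 (Fin.last _) = ⊥ :=
  Submodule.finrank_eq_zero.1 (by simpa [cut_last] using W.2.2 (Fin.last _))

theorem Flag.finrank_subquot (W : Flag I) (k : Fin I.length) :
    Module.finrank ℝ (W.Subquot k) + cut I k.castSucc = cut I k.succ := by
  have hle : W.1 k.succ ≤ W.1 k.castSucc := W.2.1 Fin.castSucc_lt_succ.le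
  have hquot : Module.finrank ℝ (W.Subquot k) + _ = _ :=
    Submodule.finrank_quotient_add_finrank ((W.1 k.succ).submoduleOf (W.1 k.castSucc))
  rw [LinearEquiv.finrank_eq (Submodule.submoduleOfEquivOfLe hle)] at hquot
  have hk := W.2.2 k.castSucc
  have hk' := W.2.2 k.succ
  omega

/-- A frame of a flag with forms: the rows of `gᵀ` are linear coordinates such that `W_k` is the
common kernel of the coordinates in the blocks before the `k`-th one, and `R_k` is half the sum of
the squares of the coordinates in the `k`-th block. -/
structure IsFrame (g : GL (Fin n) ℝ) (W : Flag I) (R : Forms W) : Prop where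
  mem_iff : ∀ k v, v ∈ W.1 k ↔ ∀ i, (block I i).castSucc < k → (g.1ᵀ *ᵥ v) i = 0
  form_eq : ∀ (k : Fin I.length) (v : W.1 k.castSucc), (R k).1 (Submodule.Quotient.mk v) =
    1 / 2 * ∑ i with block I i = k, (g.1ᵀ *ᵥ (v : Fin n → ℝ)) i ^ 2

theorem exists_flag (I : CompositionAsSet n) (g : GL (Fin n) ℝ) :
    ∃ W : Flag I, ∀ k v, v ∈ W.1 k ↔ ∀ i, (block I i).castSucc < k → (g.1ᵀ *ᵥ v) i = 0 := by
  refine ⟨⟨fun k => coordKer g.1ᵀ fun i => (block I i).castSucc < k, fun k l hkl v hv => ?_,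
    fun k => ?_⟩, fun k v => mem_coordKer⟩
  · exact mem_coordKer.2 fun i hi => mem_coordKer.1 hv i (hi.trans_le hkl)
  · rw [← card_block_lt, finrank_coordKer ((isUnit_transpose _).2 g.isUnit), Fintype.card_fin]

theorem exists_posDef_form_eq_sum_sq {V ι : Type*} [AddCommGroup V] [Module ℝ V] [Fintype ι]
    (U : Submodule ℝ V) (x : V →ₗ[ℝ] ι → ℝ) (hx : U = x.ker) :
    ∃ R : QuadraticForm ℝ (V ⧸ U), R.PosDef ∧
      ∀ v, R (Submodule.Quotient.mk v) = 1 / 2 * ∑ i, x v i ^ 2 := by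
  let R : QuadraticForm ℝ (V ⧸ U) :=
    (QuadraticMap.weightedSumSquares ℝ fun _ : ι => (1 / 2 : ℝ)).comp (U.liftQ x hx.le)
  have hR (v : V) : R (Submodule.Quotient.mk v) = 1 / 2 * ∑ i, x v i ^ 2 := by
    simp only [R, QuadraticMap.comp_apply, Submodule.liftQ_apply,
      QuadraticMap.weightedSumSquares_apply, smul_eq_mul, Finset.mul_sum, sq]
  refine ⟨R, fun y hy => ?_, hR⟩
  obtain ⟨v, rfl⟩ := Submodule.Quotient.mk_surjective _ y
  have hv : x v ≠ 0 := fun h => hy ((Submodule.Quotient.mk_eq_zero U).2 (hx ▸ h))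
  obtain ⟨i, hi⟩ := Function.ne_iff.1 hv
  rw [hR]
  refine mul_pos one_half_pos (Finset.sum_pos' (fun j _ => sq_nonneg _) ⟨i, Finset.mem_univ i, ?_⟩)
  exact sq_pos_of_ne_zero hi

theorem exists_isFrame (I : CompositionAsSet n) (g : GL (Fin n) ℝ) :
    ∃ (W : Flag I) (R : Forms W), IsFrame g W R := by
  obtain ⟨W, hW⟩ := exists_flag I g
  let x (k : Fin I.length) : W.1 k.castSucc →ₗ[ℝ] {i // block I i = k} → ℝ :=
    (LinearMap.funLeft ℝ ℝ Subtype.val).comp (g.1ᵀ.mulVecLin.comp (W.1 k.castSucc).subtype)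
  have hx (k : Fin I.length) : (W.1 k.succ).submoduleOf (W.1 k.castSucc) = (x k).ker := by
    ext v
    rw [LinearMap.mem_ker, funext_iff, Subtype.forall]
    refine (hW k.succ v).trans (forall_congr' fun i => ?_)
    rw [Fin.castSucc_lt_succ_iff, le_iff_lt_or_eq, or_imp]
    exact and_iff_right fun h => (hW k.castSucc v).1 v.2 i (Fin.castSucc_lt_castSucc_iff.2 h)
  choose R hpos hR using fun k => exists_posDef_form_eq_sum_sq _ (x k) (hx k)
  refine ⟨W, fun k => ⟨R k, hpos k⟩, hW, fun k v => (hR k v).trans ?_⟩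
  rw [Finset.sum_subtype _ (p := fun i => block I i = k) (by simp)]
  rfl

theorem exists_linearMap_posDef_eq_sum_sq {V ι : Type*} [AddCommGroup V] [Module ℝ V]
    [FiniteDimensional ℝ V] [Fintype ι] {Q : QuadraticForm ℝ V} (hQ : Q.PosDef)
    (hι : Fintype.card ι = Module.finrank ℝ V) :
    ∃ x : V →ₗ[ℝ] ι → ℝ, ∀ v, Q v = 1 / 2 * ∑ i, x v i ^ 2 := by
  obtain ⟨w, ⟨e⟩⟩ := QuadraticForm.equivalent_weightedSumSquares Q
  have hw (j : Fin (Module.finrank ℝ V)) : 0 < w j := by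
    have hwj : Q (e.symm (Pi.single j 1)) = w j := by
      rw [e.symm.map_app, QuadraticMap.weightedSumSquares_apply,
        Finset.sum_eq_single j (fun i _ hi => by simp [hi]) (by simp)]
      simp
    rw [← hwj]
    exact hQ _ (e.symm.toLinearEquiv.map_ne_zero_iff.2 (by simp))
  let eι : ι ≃ Fin (Module.finrank ℝ V) := Fintype.equivFinOfCardEq hι
  refine ⟨LinearMap.pi fun i => √(2 * w (eι i)) • (LinearMap.proj (eι i)).comp
    e.toLinearEquiv.toLinearMap, fun v => ?_⟩
  rw [← e.map_app, QuadraticMap.weightedSumSquares_apply, ← eι.sum_comp, Finset.mul_sum]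
  refine Finset.sum_congr rfl fun i _ => ?_
  have hsqrt : √(2 * w (eι i)) ^ 2 = 2 * w (eι i) :=
    Real.sq_sqrt (mul_pos two_pos (hw (eι i))).le
  change w (eι i) * (e v (eι i) * e v (eι i)) = 1 / 2 * (√(2 * w (eι i)) * e v (eι i)) ^ 2
  rw [mul_pow, hsqrt]
  ring

theorem Forms.exists_linearMap {W : Flag I} (R : Forms W) :
    ∃ x : (Fin n → ℝ) →ₗ[ℝ] Fin n → ℝ, ∀ (k : Fin I.length) (v : W.1 k.castSucc),
      (R k).1 (Submodule.Quotient.mk v) = 1 / 2 * ∑ i with block I i = k, x v i ^ 2 := by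
  have hcard (k : Fin I.length) :
      Fintype.card {i // block I i = k} = Module.finrank ℝ (W.Subquot k) := by
    have hk := W.finrank_subquot k
    have hk' := card_block_eq I k
    rw [Fintype.card_subtype]
    omega
  choose y hy using fun k => exists_linearMap_posDef_eq_sum_sq (R k).2 (hcard k)
  choose x hx using fun i => LinearMap.exists_extend
    ((LinearMap.proj ⟨i, rfl⟩).comp ((y (block I i)).comp (Submodule.mkQ _)))
  refine ⟨LinearMap.pi x, fun k v => ?_⟩
  rw [hy, Finset.sum_subtype _ (p := fun i => block I i = k) (by simp)]
  congr! 3 with ⟨i, rfl⟩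
  exact (LinearMap.congr_fun (hx i) v).symm

theorem exists_frame (W : Flag I) (R : Forms W) : ∃ g : GL (Fin n) ℝ, IsFrame g W R := by
  obtain ⟨x, hx⟩ := R.exists_linearMap
  have hmk (k : Fin I.length) (v : W.1 k.castSucc) :
      (v : Fin n → ℝ) ∈ W.1 k.succ ↔ ∀ i, block I i = k → x v i = 0 := by
    rw [← W.mk_eq_zero_iff, ← (R k).2.anisotropic.eq_zero_iff, hx]
    simp [Finset.sum_eq_zero_iff_of_nonneg, sq_nonneg]
  have hmem (k : Fin (I.length + 1)) (v : Fin n → ℝ) :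
      v ∈ W.1 k ↔ ∀ i, (block I i).castSucc < k → x v i = 0 := by
    induction k using Fin.induction with
    | zero => simp [W.zero_eq_top]
    | succ k ih =>
      simp only [Fin.castSucc_lt_succ_iff, le_iff_lt_or_eq, or_imp, forall_and]
      simp only [Fin.castSucc_lt_castSucc_iff] at ih
      rw [← ih]
      refine ⟨fun hv => ?_, fun hv => (hmk k ⟨v, hv.1⟩).2 hv.2⟩
      have hv' : v ∈ W.1 k.castSucc := W.2.1 Fin.castSucc_lt_succ.le hv
      exact ⟨hv', (hmk k ⟨v, hv'⟩).1 hv⟩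
  have hker (v : Fin n → ℝ) (hv : x v = 0) : v = 0 := by
    have hlast : v ∈ W.1 (Fin.last _) := (hmem _ v).2 fun i _ => congrFun hv i
    rwa [W.last_eq_bot, Submodule.mem_bot] at hlast
  have hunit : IsUnit (LinearMap.toMatrix' x)ᵀ := by
    rw [isUnit_transpose, ← mulVec_injective_iff_isUnit]
    simpa [injective_iff_map_eq_zero, Function.Injective, LinearMap.toMatrix'_mulVec] using
      (injective_iff_map_eq_zero x).2 hker
  obtain ⟨g, hg⟩ := hunit
  have hgx (v : Fin n → ℝ) : g.1ᵀ *ᵥ v = x v := by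
    rw [hg, transpose_transpose, LinearMap.toMatrix'_mulVec]
  refine ⟨g, fun k v => ?_, fun k v => ?_⟩
  · simpa only [hgx] using hmem k v
  · simpa only [hgx] using hx k v

end Flags

section Growth

variable {n : ℕ}

theorem quadForm_expCurve (g : GL (Fin n) ℝ) (φ : Fin n → ℝ) (t : ℝ) (v : Fin n → ℝ) :
    quadForm (expCurve g φ t) v = 1 / 2 * ∑ i, Real.exp (φ i * t) * (g.1ᵀ *ᵥ v) i ^ 2 := by
  rw [expCurve, quadForm_congruence, quadForm_diagonal]

theorem tendsto_exp_mul_of_neg {α : Type*} {l : Filter α} {t : α → ℝ} (ht : Tendsto t l atTop)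
    {a : ℝ} (ha : a < 0) : Tendsto (fun x => Real.exp (a * t x)) l (𝓝 0) :=
  Real.tendsto_exp_atBot.comp (ht.const_mul_atTop_of_neg ha)

theorem tendsto_exp_neg_mul_sum {α ι : Type*} [Fintype ι] {l : Filter α} {t : α → ℝ}
    (ht : Tendsto t l atTop) (φ : ι → ℝ) (c : ℝ) {x : α → ι → ℝ} {y : ι → ℝ}
    (hx : Tendsto x l (𝓝 y))
    (hfast : ∀ i, c < φ i → Tendsto (fun a => Real.exp ((φ i - c) * t a) * x a i ^ 2) l (𝓝 0)) :
    Tendsto (fun a => Real.exp (-(c * t a)) * (1 / 2 * ∑ i, Real.exp (φ i * t a) * x a i ^ 2)) l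
      (𝓝 (1 / 2 * ∑ i with φ i = c, y i ^ 2)) := by
  have hexp (a : α) : Real.exp (-(c * t a)) * (1 / 2 * ∑ i, Real.exp (φ i * t a) * x a i ^ 2) =
      1 / 2 * ∑ i, Real.exp ((φ i - c) * t a) * x a i ^ 2 := by
    rw [mul_left_comm, Finset.mul_sum]
    congr! 2 with i
    rw [← mul_assoc, ← Real.exp_add]
    ring_nf
  simp only [hexp, Finset.sum_filter]
  refine Tendsto.const_mul _ (tendsto_finsetSum _ fun i _ => ?_)
  have hxi : Tendsto (fun a => x a i ^ 2) l (𝓝 (y i ^ 2)) := (tendsto_pi_nhds.1 hx i).pow 2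
  rcases lt_trichotomy c (φ i) with h | h | h
  · rw [if_neg h.ne']
    exact hfast i h
  · rw [if_pos h.symm]
    simpa [h] using hxi
  · rw [if_neg h.ne]
    simpa using (tendsto_exp_mul_of_neg ht (sub_neg.2 h)).mul hxi

theorem Speeds.filter_eq {I : CompositionAsSet n} (ψ : Speeds I) (k : Fin I.length) :
    Finset.univ.filter (fun i => ψ.1 (block I i) = ψ.1 k) =
      Finset.univ.filter fun i => block I i = k := by
  simp only [ψ.2.1.injective.eq_iff]

/-- The geodesic `μ` moves with the speeds `ψ` along a frame of the flag `W` with the forms `R`. -/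
def HasFrame (μ : ParamGeodesic n) {I : CompositionAsSet n} (ψ : Speeds I) (W : Flag I)
    (R : Forms W) : Prop :=
  ∃ g : GL (Fin n) ℝ, (μ.toFun = expCurve g fun i => ψ.1 (block I i)) ∧ IsFrame g W R

theorem HasFrame.tendsto_quadForm {μ : ParamGeodesic n} {I : CompositionAsSet n} {ψ : Speeds I}
    {W : Flag I} {R : Forms W} (h : HasFrame μ ψ W R) {α : Type*} {l : Filter α} {t : α → ℝ}
    (ht : Tendsto t l atTop) {k : Fin I.length} (v : W.1 k.castSucc) :
    Tendsto (fun a => Real.exp (-(ψ.1 k * t a)) * quadForm (μ.toFun (t a)) v) l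
      (𝓝 ((R k).1 (Submodule.Quotient.mk v))) := by
  obtain ⟨g, hg, hframe⟩ := h
  rw [hframe.form_eq, hg, ← ψ.filter_eq]
  simp only [quadForm_expCurve]
  refine tendsto_exp_neg_mul_sum ht _ _ tendsto_const_nhds fun i hi => ?_
  rw [(hframe.mem_iff _ _).1 v.2 i (Fin.castSucc_lt_castSucc_iff.2 (ψ.2.1.lt_iff_gt.1 hi))]
  simpa using tendsto_const_nhds

end Growth

section Levels

variable {n : ℕ} {I I' : CompositionAsSet n}

/-- The level of a nonzero vector in a flag is the last `k` with `v ∈ W_k`; it determines the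
growth rate of the quadratic forms `½ vᵀ μ(t) v`. -/
def Flag.IsLevel (W : Flag I) (v : Fin n → ℝ) (k : Fin I.length) : Prop :=
  v ∈ W.1 k.castSucc ∧ v ∉ W.1 k.succ

theorem Flag.exists_isLevel (W : Flag I) {v : Fin n → ℝ} (hv : v ≠ 0) : ∃ k, W.IsLevel v k := by
  by_contra! h
  have hmem (k : Fin (I.length + 1)) : v ∈ W.1 k :=
    Fin.induction (by simp [W.zero_eq_top]) (fun k hk => not_not.1 fun hk' => h k ⟨hk, hk'⟩) k
  exact hv (by simpa [W.last_eq_bot] using hmem (Fin.last _))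

theorem Flag.exists_of_isLevel (W : Flag I) (k : Fin I.length) : ∃ v, W.IsLevel v k := by
  refine SetLike.not_le_iff_exists.1 fun hle => ?_
  have hrank := Submodule.finrank_mono hle
  have hk := W.2.2 k.castSucc
  have hk' := W.2.2 k.succ
  have hcut : (cut I k.castSucc : ℕ) < cut I k.succ := cut_strictMono I Fin.castSucc_lt_succ
  omega

theorem Flag.IsLevel.ne_zero {W : Flag I} {v : Fin n → ℝ} {k : Fin I.length}
    (h : W.IsLevel v k) : v ≠ 0 :=
  ne_of_mem_of_not_mem (Submodule.zero_mem _) h.2 |>.symm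

theorem Flag.IsLevel.mem_iff {W : Flag I} {v : Fin n → ℝ} {k : Fin I.length}
    (h : W.IsLevel v k) (j : Fin I.length) : v ∈ W.1 j.castSucc ↔ j ≤ k := by
  refine ⟨fun hj => not_lt.1 fun hlt => ?_, fun hj => ?_⟩
  · exact h.2 (W.2.1 (Fin.succ_le_castSucc_iff.2 hlt) hj)
  · exact W.2.1 (Fin.castSucc_le_castSucc_iff.2 hj) h.1

theorem Flag.IsLevel.form_pos {W : Flag I} {v : Fin n → ℝ} {k : Fin I.length}
    (h : W.IsLevel v k) (R : Forms W) : 0 < (R k).1 (Submodule.Quotient.mk ⟨v, h.1⟩) :=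
  (R k).2 _ fun h0 => h.2 ((W.mk_eq_zero_iff ⟨v, h.1⟩).1 h0)

theorem Flag.exists_eq_of_speeds {ψ : Speeds I} {ψ' : Speeds I'} {W : Flag I} {W' : Flag I'} {a : ℝ}
    (ha : 0 < a) (h : ∀ v k k', W.IsLevel v k → W'.IsLevel v k' → ψ.1 k = a * ψ'.1 k')
    (k : Fin (I.length + 1)) : ∃ k', W.1 k = W'.1 k' := by
  induction k using Fin.lastCases with
  | last => exact ⟨Fin.last _, by rw [W.last_eq_bot, W'.last_eq_bot]⟩
  | cast k =>
    obtain ⟨w, hw⟩ := W.exists_of_isLevel k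
    obtain ⟨k', hw'⟩ := W'.exists_isLevel hw.ne_zero
    refine ⟨k'.castSucc, SetLike.ext fun v => ?_⟩
    rcases eq_or_ne v 0 with rfl | hv
    · simp only [Submodule.zero_mem]
    obtain ⟨i, hi⟩ := W.exists_isLevel hv
    obtain ⟨i', hi'⟩ := W'.exists_isLevel hv
    rw [hi.mem_iff, hi'.mem_iff, ← ψ.2.1.le_iff_ge, ← ψ'.2.1.le_iff_ge, h v i i' hi hi',
      h w k k' hw hw', mul_le_mul_iff_right₀ ha]

theorem Flag.boundaries_subset {W : Flag I} {W' : Flag I'} (h : ∀ k, ∃ k', W.1 k = W'.1 k') :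
    I.boundaries ⊆ I'.boundaries := by
  intro j hj
  obtain ⟨k, rfl⟩ := (mem_boundaries_iff I).1 hj
  obtain ⟨k', hk'⟩ := h k
  refine (mem_boundaries_iff I').2 ⟨k', Fin.ext (Nat.add_left_cancel ((W'.2.2 k').trans ?_))⟩
  rw [← hk', W.2.2]

theorem Flag.eq_of_forall_exists_eq {W W' : Flag I} (h : ∀ k, ∃ k', W.1 k = W'.1 k') : W = W' := by
  refine Subtype.ext (funext fun k => ?_)
  obtain ⟨k', hk'⟩ := h k
  have hcut : cut I k = cut I k' :=
    Fin.ext (Nat.add_left_cancel ((W.2.2 k).trans (by rw [hk', W'.2.2])))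
  rwa [(cut_strictMono I).injective hcut] at hk' ⊢

end Levels

section Comparison

variable {n : ℕ} {I I' : CompositionAsSet n}

theorem HasFrame.tendsto_log_quadForm {μ : ParamGeodesic n} {ψ : Speeds I} {W : Flag I}
    {R : Forms W} (h : HasFrame μ ψ W R) {α : Type*} {l : Filter α} {t : α → ℝ}
    (ht : Tendsto t l atTop) {k : Fin I.length} {v : Fin n → ℝ} (hv : W.IsLevel v k) :
    Tendsto (fun a => Real.log (quadForm (μ.toFun (t a)) v) - ψ.1 k * t a) l
      (𝓝 (Real.log ((R k).1 (Submodule.Quotient.mk ⟨v, hv.1⟩)))) := by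
  refine ((h.tendsto_quadForm ht ⟨v, hv.1⟩).log (hv.form_pos R).ne').congr fun a => ?_
  rw [Real.log_mul (Real.exp_pos _).ne' (quadForm_pos (μ.posDef _) hv.ne_zero).ne', Real.log_exp]
  ring

theorem exists_tendsto_div_of_tendsto_sub {α : Type*} {l : Filter α} [l.NeBot] {t s : α → ℝ}
    (ht : Tendsto t l atTop) (hs : Tendsto s l atTop) {x y d : ℝ} (hx : x ≠ 0)
    (h : Tendsto (fun N => x * t N - y * s N) l (𝓝 d)) :
    ∃ a, 0 < a ∧ Tendsto (fun N => s N / t N) l (𝓝 a) := by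
  have hdiv : Tendsto (fun N => y * (s N / t N)) l (𝓝 x) := by
    have hsub := (h.div_atTop ht).const_sub x
    rw [sub_zero] at hsub
    refine hsub.congr' ?_
    filter_upwards [ht.eventually_gt_atTop 0] with N hN
    field_simp
    ring
  have hy : y ≠ 0 := by
    rintro rfl
    simp only [zero_mul] at hdiv
    exact hx (tendsto_nhds_unique hdiv tendsto_const_nhds)
  have hst : Tendsto (fun N => s N / t N) l (𝓝 (y⁻¹ * x)) := by
    simpa only [inv_mul_cancel_left₀ hy] using hdiv.const_mul y⁻¹
  refine ⟨y⁻¹ * x, (ge_of_tendsto hst ?_).lt_of_ne' (mul_ne_zero (inv_ne_zero hy) hx), hst⟩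
  filter_upwards [ht.eventually_ge_atTop 0, hs.eventually_ge_atTop 0] with N h1 h2
  exact div_nonneg h2 h1

theorem exists_proportional_of_tendsto_sub {α ι : Type*} {l : Filter α} [l.NeBot] {t s : α → ℝ}
    (ht : Tendsto t l atTop) (hs : Tendsto s l atTop) {x y d : ι → ℝ} (hx : x ≠ 0)
    (h : ∀ i, Tendsto (fun N => x i * t N - y i * s N) l (𝓝 (d i))) :
    ∃ a c : ℝ, 0 < a ∧ ∀ i, x i = a * y i ∧ d i = y i * c := by
  obtain ⟨j, hj⟩ := Function.ne_iff.1 hx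
  obtain ⟨a, ha, hst⟩ := exists_tendsto_div_of_tendsto_sub ht hs hj (h j)
  have hxy (i : ι) : x i = a * y i := by
    have hzero : Tendsto (fun N => x i - y i * (s N / t N)) l (𝓝 0) := by
      refine ((h i).div_atTop ht).congr' ?_
      filter_upwards [ht.eventually_gt_atTop 0] with N hN
      field_simp
    linarith [tendsto_nhds_unique hzero ((hst.const_mul (y i)).const_sub (x i))]
  have hprod (i : ι) : Tendsto (fun N => y i * (a * t N - s N)) l (𝓝 (d i)) := by
    refine (h i).congr fun N => ?_
    rw [hxy i]
    ring
  have hyj : y j ≠ 0 := fun h0 => hj (by simp [hxy j, h0])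
  have hc : Tendsto (fun N => a * t N - s N) l (𝓝 ((y j)⁻¹ * d j)) := by
    simpa only [inv_mul_cancel_left₀ hyj] using (hprod j).const_mul (y j)⁻¹
  exact ⟨a, _, ha, fun i => ⟨hxy i, tendsto_nhds_unique (hprod i) (hc.const_mul (y i))⟩⟩

theorem HasFrame.exists_proportional {μ ν : ParamGeodesic n} {ψ : Speeds I} {ψ' : Speeds I'}
    {W : Flag I} {W' : Flag I'} {R : Forms W} {R' : Forms W'} (hμ : HasFrame μ ψ W R)
    (hν : HasFrame ν ψ' W' R') {α : Type*} {l : Filter α} [l.NeBot] {t s : α → ℝ}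
    (ht : Tendsto t l atTop) (hs : Tendsto s l atTop)
    (h : ∀ v : Fin n → ℝ, v ≠ 0 → Tendsto (fun N => Real.log (quadForm (ν.toFun (s N)) v) -
      Real.log (quadForm (μ.toFun (t N)) v)) l (𝓝 0)) :
    ∃ a c : ℝ, 0 < a ∧ ∀ v k k' (hk : W.IsLevel v k) (hk' : W'.IsLevel v k'),
      ψ.1 k = a * ψ'.1 k' ∧ (R' k').1 (Submodule.Quotient.mk ⟨v, hk'.1⟩) =
        Real.exp (ψ'.1 k' * c) * (R k).1 (Submodule.Quotient.mk ⟨v, hk.1⟩) := by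
  let ι := {p : (Fin n → ℝ) × Fin I.length × Fin I'.length //
    W.IsLevel p.1 p.2.1 ∧ W'.IsLevel p.1 p.2.2}
  have hsub (p : ι) : Tendsto (fun N => ψ.1 p.1.2.1 * t N - ψ'.1 p.1.2.2 * s N) l
      (𝓝 (Real.log ((R' p.1.2.2).1 (Submodule.Quotient.mk ⟨p.1.1, p.2.2.1⟩)) -
        Real.log ((R p.1.2.1).1 (Submodule.Quotient.mk ⟨p.1.1, p.2.1.1⟩)))) := by
    have hlim := ((hν.tendsto_log_quadForm hs p.2.2).sub (hμ.tendsto_log_quadForm ht p.2.1)).sub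
      (h p.1.1 p.2.1.ne_zero)
    rw [sub_zero] at hlim
    exact hlim.congr fun N => by ring
  obtain ⟨k₀, hk₀⟩ := Function.ne_iff.1 ψ.2.2
  obtain ⟨v₀, hv₀⟩ := W.exists_of_isLevel k₀
  obtain ⟨k₀', hv₀'⟩ := W'.exists_isLevel hv₀.ne_zero
  obtain ⟨a, c, ha, hac⟩ := exists_proportional_of_tendsto_sub ht hs
    (Function.ne_iff.2 ⟨(⟨(v₀, k₀, k₀'), hv₀, hv₀'⟩ : ι), hk₀⟩) hsub
  refine ⟨a, c, ha, fun v k k' hk hk' => ?_⟩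
  obtain ⟨hψ, hlog⟩ := hac ⟨(v, k, k'), hk, hk'⟩
  refine ⟨hψ, ?_⟩
  rw [← hlog, Real.exp_sub, Real.exp_log (hk'.form_pos R'), Real.exp_log (hk.form_pos R),
    div_mul_cancel₀ _ (hk.form_pos R).ne']

/-- `b` consists of the speeds of the geodesic `μ` and the flag with forms that has the frame
of `μ`.  Unlike `HasBoundaryData` this does not refer to any limits. -/
def HasFrameData (μ : ParamGeodesic n) (b : BoundaryData n) : Prop :=
  ∃ (ψ : Speeds b.I) (R : Forms b.W), HasFrame μ ψ b.W R ∧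
    ψ.toSimplex = b.δ ∧ Quotient.mk (formsSetoid b.δ b.W) R = b.R

theorem HasFrameData.eq_of_tendsto {μ ν : ParamGeodesic n} {b b' : BoundaryData n}
    (hμ : HasFrameData μ b) (hν : HasFrameData ν b') {α : Type*} {l : Filter α} [l.NeBot]
    {t s : α → ℝ} (ht : Tendsto t l atTop) (hs : Tendsto s l atTop)
    (h : ∀ v : Fin n → ℝ, v ≠ 0 → Tendsto (fun N => Real.log (quadForm (ν.toFun (s N)) v) -
      Real.log (quadForm (μ.toFun (t N)) v)) l (𝓝 0)) : b = b' := by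
  obtain ⟨I, δ, W, C⟩ := b
  obtain ⟨I', δ', W', C'⟩ := b'
  obtain ⟨ψ, R, hframe, hδ, hR⟩ := hμ
  obtain ⟨ψ', R', hframe', hδ', hR'⟩ := hν
  dsimp only at ψ R ψ' R' hframe hframe' hδ hδ' hR hR'
  obtain ⟨a, c, ha, hac⟩ := hframe.exists_proportional hframe' ht hs h
  have hW := Flag.exists_eq_of_speeds ha fun v k k' hk hk' => (hac v k k' hk hk').1
  have hW' : ∀ k, ∃ k', W'.1 k = W.1 k' :=
    Flag.exists_eq_of_speeds (inv_pos.2 ha) fun v k' k hk' hk => by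
      rw [(hac v k k' hk hk').1, inv_mul_cancel_left₀ ha.ne']
  obtain rfl : I = I' := CompositionAsSet.ext
    ((Flag.boundaries_subset hW).antisymm (Flag.boundaries_subset hW'))
  obtain rfl : W = W' := Flag.eq_of_forall_exists_eq hW
  have hψ (k : Fin I.length) : ψ.1 k = a * ψ'.1 k := by
    obtain ⟨v, hv⟩ := W.exists_of_isLevel k
    exact (hac v k k hv hv).1
  obtain rfl : δ = δ' := hδ.symm.trans ((Quotient.sound ⟨a, ha, hψ⟩ :
    ψ'.toSimplex = ψ.toSimplex).symm.trans hδ')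
  have hform (k : Fin I.length) (x : W.Subquot k) :
      (R' k).1 x = Real.exp (ψ'.1 k * c) * (R k).1 x := by
    obtain ⟨v, rfl⟩ := Submodule.Quotient.mk_surjective _ x
    by_cases hv : (v : Fin n → ℝ) ∈ W.1 k.succ
    · simp only [(W.mk_eq_zero_iff v).2 hv, QuadraticMap.map_zero, mul_zero]
    · exact (hac v k k ⟨v.2, hv⟩ ⟨v.2, hv⟩).2
  rw [← hR, ← hR']
  exact congrArg (BoundaryData.mk I _ W) (Quotient.sound ⟨ψ', hδ', c, hform⟩)

theorem HasFrameData.unique {μ : ParamGeodesic n} {b b' : BoundaryData n} (h : HasFrameData μ b)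
    (h' : HasFrameData μ b') : b = b' :=
  h.eq_of_tendsto h' tendsto_id tendsto_id fun v _ => by simp

theorem HasFrameData.eq_of_nullAsymptotic {μ ν : ParamGeodesic n} {b b' : BoundaryData n}
    (hμ : HasFrameData μ b) (hν : HasFrameData ν b') (h : NullAsymptotic μ ν) : b = b' := by
  obtain ⟨t, s, ht, hs, hr⟩ := h.exists_seq
  refine hμ.eq_of_tendsto hν ht hs fun v hv => ?_
  exact squeeze_zero_norm (fun N => abs_log_quadForm_sub_le_rho (μ.posDef _) (ν.posDef _) hv) hr

end Comparison

section SameFrameData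

variable {n : ℕ}

theorem eq_of_quadForm_eq {X Y : Matrix (Fin n) (Fin n) ℝ} (hX : X.IsSymm) (hY : Y.IsSymm)
    (h : ∀ v, quadForm X v = quadForm Y v) : X = Y := by
  have hdot (v : Fin n → ℝ) : v ⬝ᵥ X *ᵥ v = v ⬝ᵥ Y *ᵥ v := by
    have := h v
    rw [quadForm_eq, quadForm_eq] at this
    linarith
  ext i j
  have hsum := hdot (Pi.single i 1 + Pi.single j 1)
  have hi := hdot (Pi.single i 1)
  have hj := hdot (Pi.single j 1)
  simp only [mulVec_add, dotProduct_add, add_dotProduct, mulVec_single_one,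
    single_one_dotProduct, col_apply] at hsum hi hj
  linarith [hX.apply i j, hY.apply i j]

/-- The block diagonal part of `M`, for the partition of the indices into the fibres of `b`. -/
def diagonalBlocks {ι κ : Type*} [DecidableEq κ] (b : ι → κ) (M : Matrix ι ι ℝ) : Matrix ι ι ℝ :=
  of fun i j => if b i = b j then M i j else 0

theorem diagonalBlocks_mulVec {ι κ : Type*} [Fintype ι] [DecidableEq κ] (b : ι → κ)
    (M : Matrix ι ι ℝ) (x : ι → ℝ) (i : ι) :
    (diagonalBlocks b M *ᵥ x) i = (M *ᵥ fun j => if b j = b i then x j else 0) i := by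
  simp [diagonalBlocks, mulVec, dotProduct, eq_comm]

/-- The element `diag(e^{φ₁}, …, e^{φₙ})` of the general linear group. -/
def diagonalExp (φ : Fin n → ℝ) : GL (Fin n) ℝ where
  val := diagonal fun i => Real.exp (φ i)
  inv := diagonal fun i => Real.exp (-φ i)
  val_inv := by simp [← Real.exp_add]
  inv_val := by simp [← Real.exp_add]

theorem transpose_mul_diagonalExp_mulVec (g : GL (Fin n) ℝ) (φ v : Fin n → ℝ) (i : Fin n) :
    ((g * diagonalExp φ).1ᵀ *ᵥ v) i = Real.exp (φ i) * (g.1ᵀ *ᵥ v) i := by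
  simp [diagonalExp, ← mulVec_mulVec, mulVec_diagonal]

theorem expCurve_mul_diagonalExp (g : GL (Fin n) ℝ) (φ : Fin n → ℝ) (s t : ℝ) :
    expCurve (g * diagonalExp fun i => φ i * s / 2) φ t = expCurve g φ (t + s) := by
  simp only [expCurve, Units.val_mul, ← congruence_congruence]
  simp only [congruence, diagonalExp, diagonal_transpose, diagonal_mul_diagonal, ← Real.exp_add]
  congr! 5
  ring

theorem tendsto_congruence_one {α : Type*} {l : Filter α} {f : α → Matrix (Fin n) (Fin n) ℝ}
    {M : Matrix (Fin n) (Fin n) ℝ} (hf : Tendsto f l (𝓝 M)) :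
    Tendsto (fun a => congruence (f a) 1) l (𝓝 (congruence M 1)) := by
  have hcont : Continuous fun X : Matrix (Fin n) (Fin n) ℝ => congruence X 1 := by
    unfold congruence
    fun_prop
  exact (hcont.tendsto M).comp hf

theorem rho_congruence_one_congruence_one (g h : GL (Fin n) ℝ) :
    rho (congruence g.1 1) (congruence h.1 1) = rho 1 (congruence (g⁻¹ * h).1 1) := by
  rw [← rho_congruence g 1, congruence_congruence, ← Units.val_mul, mul_inv_cancel_left]

theorem tendsto_diagonalExp_conj {φ : Fin n → ℝ} {M : Matrix (Fin n) (Fin n) ℝ}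
    (hM : ∀ i j, φ i < φ j → M i j = 0) :
    Tendsto (fun t : ℝ => (diagonalExp fun i => φ i * t / 2)⁻¹.1 * M *
      (diagonalExp fun i => φ i * t / 2).1) atTop (𝓝 (diagonalBlocks φ M)) := by
  refine tendsto_matrix_iff.2 fun i j => ?_
  have hentry (t : ℝ) : ((diagonalExp fun i => φ i * t / 2)⁻¹.1 * M *
      (diagonalExp fun i => φ i * t / 2).1) i j = Real.exp ((φ j - φ i) / 2 * t) * M i j := by
    simp only [diagonalExp, Units.inv_mk, diagonal_mul, mul_diagonal]
    rw [mul_right_comm, ← Real.exp_add]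
    ring_nf
  simp only [hentry, diagonalBlocks, of_apply]
  rcases lt_trichotomy (φ i) (φ j) with h | h | h
  · simp [hM i j h]
  · simp [h]
  · simpa [h.ne'] using
      (tendsto_exp_mul_of_neg tendsto_id (by linarith : (φ j - φ i) / 2 < 0)).mul_const (M i j)

variable {I : CompositionAsSet n} {W : Flag I} {R R' : Forms W} {g h : GL (Fin n) ℝ}

theorem IsFrame.scale (hg : IsFrame g W R) {θ : Fin I.length → ℝ}
    (hR : ∀ k x, (R' k).1 x = Real.exp (θ k) * (R k).1 x) :
    IsFrame (g * diagonalExp fun i => θ (block I i) / 2) W R' where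
  mem_iff k v := by
    simp only [hg.mem_iff, transpose_mul_diagonalExp_mulVec, mul_eq_zero, Real.exp_ne_zero,
      false_or]
  form_eq k v := by
    rw [hR, hg.form_eq, mul_left_comm, Finset.mul_sum]
    congr 1
    refine Finset.sum_congr rfl fun i hi => ?_
    rw [transpose_mul_diagonalExp_mulVec, mul_pow, ← Real.exp_nat_mul, (Finset.mem_filter.1 hi).2]
    congr 2
    push_cast
    ring

theorem transpose_mulVec_transpose_inv_mulVec (g h : GL (Fin n) ℝ) (x : Fin n → ℝ) :
    h.1ᵀ *ᵥ (g⁻¹.1ᵀ *ᵥ x) = (g⁻¹ * h).1ᵀ *ᵥ x := by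
  rw [mulVec_mulVec, ← transpose_mul, Units.val_mul]

theorem transpose_mulVec_transpose_inv_mulVec_self (g : GL (Fin n) ℝ) (x : Fin n → ℝ) :
    g.1ᵀ *ᵥ (g⁻¹.1ᵀ *ᵥ x) = x := by
  rw [transpose_mulVec_transpose_inv_mulVec, inv_mul_cancel, Units.val_one, transpose_one,
    one_mulVec]

theorem IsFrame.transition_apply_eq_zero (hg : IsFrame g W R) (hh : IsFrame h W R') {i j : Fin n}
    (hij : block I j < block I i) : (g⁻¹ * h).1 i j = 0 := by
  have hmem : g⁻¹.1ᵀ *ᵥ Pi.single i 1 ∈ W.1 (block I i).castSucc := by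
    refine (hg.mem_iff _ _).2 fun l hl => ?_
    rw [transpose_mulVec_transpose_inv_mulVec_self, Pi.single_eq_of_ne]
    rintro rfl
    exact hl.false
  have hzero := (hh.mem_iff _ _).1 hmem j (Fin.castSucc_lt_castSucc_iff.2 hij)
  rwa [transpose_mulVec_transpose_inv_mulVec, mulVec_single_one] at hzero

theorem IsFrame.sum_block_transition_sq (hg : IsFrame g W R) (hh : IsFrame h W R)
    (k : Fin I.length) {x : Fin n → ℝ} (hx : ∀ i, block I i ≠ k → x i = 0) :
    ∑ i with block I i = k, ((g⁻¹ * h).1ᵀ *ᵥ x) i ^ 2 = ∑ i with block I i = k, x i ^ 2 := by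
  have hmem : g⁻¹.1ᵀ *ᵥ x ∈ W.1 k.castSucc := by
    refine (hg.mem_iff _ _).2 fun i hi => ?_
    rw [transpose_mulVec_transpose_inv_mulVec_self]
    exact hx i (Fin.castSucc_lt_castSucc_iff.1 hi).ne
  have hform := (hh.form_eq k ⟨_, hmem⟩).symm.trans (hg.form_eq k ⟨_, hmem⟩)
  simp only [transpose_mulVec_transpose_inv_mulVec_self, transpose_mulVec_transpose_inv_mulVec g h]
    at hform
  linarith

theorem IsFrame.congruence_diagonalBlocks_transition (hg : IsFrame g W R) (hh : IsFrame h W R) :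
    congruence (diagonalBlocks (block I) (g⁻¹ * h).1) 1 = 1 := by
  refine eq_of_quadForm_eq (isSymm_congruence _ isSymm_one) isSymm_one fun x => ?_
  have hT : (diagonalBlocks (block I) (g⁻¹ * h).1)ᵀ = diagonalBlocks (block I) (g⁻¹ * h).1ᵀ := by
    ext i j
    simp [diagonalBlocks, eq_comm]
  rw [quadForm_congruence, quadForm_one, quadForm_one, hT,
    ← Finset.sum_fiberwise _ (block I), ← Finset.sum_fiberwise _ (block I) fun i => x i ^ 2]
  congr 1
  refine Finset.sum_congr rfl fun k _ => ?_
  let y (i : Fin n) : ℝ := if block I i = k then x i else 0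
  calc ∑ i with block I i = k, (diagonalBlocks (block I) (g⁻¹ * h).1ᵀ *ᵥ x) i ^ 2
      = ∑ i with block I i = k, ((g⁻¹ * h).1ᵀ *ᵥ y) i ^ 2 := by
        refine Finset.sum_congr rfl fun i hi => ?_
        rw [diagonalBlocks_mulVec, (Finset.mem_filter.1 hi).2]
    _ = ∑ i with block I i = k, y i ^ 2 :=
        hg.sum_block_transition_sq hh k fun i hi => if_neg hi
    _ = ∑ i with block I i = k, x i ^ 2 :=
        Finset.sum_congr rfl fun i hi => by simp only [y, if_pos (Finset.mem_filter.1 hi).2]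

theorem IsFrame.tendsto_rho (hg : IsFrame g W R) (hh : IsFrame h W R) (ψ : Speeds I) :
    Tendsto (fun t => rho (expCurve g (fun i => ψ.1 (block I i)) t)
      (expCurve h (fun i => ψ.1 (block I i)) t)) atTop (𝓝 0) := by
  set φ : Fin n → ℝ := fun i => ψ.1 (block I i)
  let E (t : ℝ) : GL (Fin n) ℝ := diagonalExp fun i => φ i * t / 2
  have hexp (f : GL (Fin n) ℝ) (t : ℝ) : expCurve f φ t = congruence (f * E t).1 1 := by
    rw [← expCurve_zero (f * E t) φ, expCurve_mul_diagonalExp, zero_add]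
  have hrho (t : ℝ) : rho (expCurve g φ t) (expCurve h φ t) =
      rho 1 (congruence ((E t)⁻¹.1 * (g⁻¹ * h).1 * (E t).1) 1) := by
    rw [hexp, hexp, rho_congruence_one_congruence_one]
    rw [_root_.mul_inv_rev, ← Units.val_mul, ← Units.val_mul, mul_assoc, mul_assoc, mul_assoc]
  have hblocks : diagonalBlocks φ (g⁻¹ * h).1 = diagonalBlocks (block I) (g⁻¹ * h).1 := by
    simp only [diagonalBlocks, φ, ψ.2.1.injective.eq_iff]
  have hlim : Tendsto (fun t => (E t)⁻¹.1 * (g⁻¹ * h).1 * (E t).1) atTop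
      (𝓝 (diagonalBlocks φ (g⁻¹ * h).1)) :=
    tendsto_diagonalExp_conj fun i j hij =>
      hg.transition_apply_eq_zero hh (ψ.2.1.lt_iff_gt.1 hij)
  have hone := tendsto_congruence_one hlim
  rw [hblocks, hg.congruence_diagonalBlocks_transition hh] at hone
  exact (tendsto_rho_one (fun t => posDef_congruence PosDef.one ((E t)⁻¹ * (g⁻¹ * h) * E t))
    hone).congr fun t => (hrho t).symm

theorem IsFrame.tendsto_rho_of_scale (hg : IsFrame g W R) (hh : IsFrame h W R') (ψ : Speeds I)
    (s : ℝ) (hR : ∀ k x, (R' k).1 x = Real.exp (ψ.1 k * s) * (R k).1 x) :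
    Tendsto (fun t => rho (expCurve g (fun i => ψ.1 (block I i)) t)
      (expCurve h (fun i => ψ.1 (block I i)) (t - s))) atTop (𝓝 0) := by
  have hlim := ((hg.scale hR).tendsto_rho hh ψ).comp
    (tendsto_atTop_add_const_right atTop (-s) tendsto_id)
  refine hlim.congr fun t => ?_
  simp only [Function.comp_apply, expCurve_mul_diagonalExp, id, neg_add_cancel_right,
    sub_eq_add_neg]

theorem HasFrameData.nullAsymptotic {μ ν : ParamGeodesic n} {b : BoundaryData n}
    (hμ : HasFrameData μ b) (hν : HasFrameData ν b) : NullAsymptotic μ ν := by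
  obtain ⟨ψ, R, ⟨g, hg, hgW⟩, hδ, hR⟩ := hμ
  obtain ⟨ψ', R', ⟨h, hh, hhW⟩, hδ', hR'⟩ := hν
  obtain ⟨a, ha, hψ⟩ : (speedsSetoid b.I).r ψ ψ' := Quotient.exact (hδ.trans hδ'.symm)
  obtain ⟨ψ₀, hδ₀, s, hs⟩ : (formsSetoid b.δ b.W).r R R' := Quotient.exact (hR.trans hR'.symm)
  obtain ⟨a₀, -, hψ₀⟩ : (speedsSetoid b.I).r ψ ψ₀ := Quotient.exact (hδ.trans hδ₀.symm)
  have hlim := hgW.tendsto_rho_of_scale hhW ψ (a₀ * s) fun k x => by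
    rw [hs, hψ₀, mul_assoc, mul_left_comm]
  have hshift : Tendsto (fun t : ℝ => a⁻¹ * (t - a₀ * s)) atTop atTop :=
    (tendsto_atTop_add_const_right _ _ tendsto_id).const_mul_atTop (inv_pos.2 ha)
  refine nullAsymptotic_of_tendsto hshift (hlim.congr fun t => ?_)
  rw [hg, hh]
  congr 1
  simp only [expCurve, hψ]
  congr! 4
  field_simp

end SameFrameData

section FrobeniusNorm

variable {ι : Type*} [Fintype ι]

/-- The square of the Frobenius norm.  Mathlib's norm is a scoped instance and has a square root
that would have to be removed in all estimates. -/
def frobeniusSq (M : Matrix ι ι ℝ) : ℝ := ∑ i, ∑ j, M i j ^ 2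

theorem frobeniusSq_nonneg (M : Matrix ι ι ℝ) : 0 ≤ frobeniusSq M :=
  Finset.sum_nonneg fun _ _ => Finset.sum_nonneg fun _ _ => sq_nonneg _

theorem frobeniusSq_eq_trace (M : Matrix ι ι ℝ) : frobeniusSq M = trace (M * Mᵀ) := by
  simp only [frobeniusSq, trace, diag_apply, mul_apply, transpose_apply, sq]

theorem frobeniusSq_transpose (M : Matrix ι ι ℝ) : frobeniusSq Mᵀ = frobeniusSq M := by
  rw [frobeniusSq_eq_trace, frobeniusSq_eq_trace, transpose_transpose, trace_mul_comm]

theorem frobeniusSq_mul_orthogonal [DecidableEq ι] (M : Matrix ι ι ℝ) (U : orthogonalGroup ι ℝ) :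
    frobeniusSq (M * U.1) = frobeniusSq M := by
  rw [frobeniusSq_eq_trace, frobeniusSq_eq_trace, transpose_mul, Matrix.mul_assoc,
    ← Matrix.mul_assoc U.1, (mem_orthogonalGroup_iff _ _).1 U.2, Matrix.one_mul]

theorem abs_apply_le_sqrt_frobeniusSq (M : Matrix ι ι ℝ) (i j : ι) :
    |M i j| ≤ √(frobeniusSq M) := by
  refine Real.abs_le_sqrt ?_
  calc M i j ^ 2 ≤ ∑ j, M i j ^ 2 :=
        Finset.single_le_sum (f := fun j => M i j ^ 2) (fun _ _ => sq_nonneg _) (Finset.mem_univ j)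
    _ ≤ frobeniusSq M := Finset.single_le_sum (f := fun i => ∑ j, M i j ^ 2)
        (fun _ _ => Finset.sum_nonneg fun _ _ => sq_nonneg _) (Finset.mem_univ i)

theorem sum_mulVec_sq_le (M : Matrix ι ι ℝ) (v : ι → ℝ) :
    ∑ i, (M *ᵥ v) i ^ 2 ≤ frobeniusSq M * ∑ i, v i ^ 2 := by
  rw [frobeniusSq, Finset.sum_mul]
  exact Finset.sum_le_sum fun i _ => Finset.sum_mul_sq_le_sq_mul_sq _ _ _

end FrobeniusNorm

section Eigenvalues

variable {n : ℕ}

/-- A form of the minimax principle: some vector has no components of index `> d` in the first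
diagonalization and no components of index `< d` in the second one. -/
theorem le_frobeniusSq_mul_of_congruence_diagonal_eq {A B : GL (Fin n) ℝ} {a b : Fin n → ℝ}
    (ha : Antitone a) (hb : Antitone b) (hb0 : ∀ i, 0 ≤ b i)
    (h : congruence A.1 (diagonal a) = congruence B.1 (diagonal b)) (d : Fin n) :
    a d ≤ frobeniusSq (A⁻¹ * B).1 * b d := by
  have hA : IsUnit A.1ᵀ := (isUnit_transpose _).2 A.isUnit
  obtain ⟨v, hv, hvA, hvB⟩ := exists_ne_zero_of_card_add_card_lt (p := fun i => d < i)
    (q := fun i => i < d) hA ((isUnit_transpose _).2 B.isUnit) (by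
      rw [Finset.filter_lt_eq_Ioi, Finset.filter_gt_eq_Iio, Fin.card_Ioi, Fin.card_Iio,
        Fintype.card_fin]
      omega)
  set x := A.1ᵀ *ᵥ v
  set y := B.1ᵀ *ᵥ v
  have hform : ∑ i, a i * x i ^ 2 = ∑ i, b i * y i ^ 2 := by
    have := congrArg (quadForm · v) h
    simp only [quadForm_congruence, quadForm_diagonal] at this
    linarith
  have hx : 0 < ∑ i, x i ^ 2 := by
    have hx0 : x ≠ 0 := fun h0 => hv (mulVec_injective_iff_isUnit.2 hA (by simpa [x] using h0))
    obtain ⟨i, hi⟩ := Function.ne_iff.1 hx0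
    exact Finset.sum_pos' (fun _ _ => sq_nonneg _) ⟨i, Finset.mem_univ _, sq_pos_of_ne_zero hi⟩
  have hyx : ∑ i, y i ^ 2 ≤ frobeniusSq (A⁻¹ * B).1 * ∑ i, x i ^ 2 := by
    have hy : y = (A⁻¹ * B).1ᵀ *ᵥ x := by
      rw [mulVec_mulVec, ← transpose_mul, ← Units.val_mul, mul_inv_cancel_left]
    rw [hy, ← frobeniusSq_transpose]
    exact sum_mulVec_sq_le _ _
  refine le_of_mul_le_mul_right ?_ hx
  calc a d * ∑ i, x i ^ 2 ≤ ∑ i, a i * x i ^ 2 := by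
        rw [Finset.mul_sum]
        refine Finset.sum_le_sum fun i _ => ?_
        rcases lt_or_ge d i with hi | hi
        · simp [hvA i hi]
        · exact mul_le_mul_of_nonneg_right (ha hi) (sq_nonneg _)
    _ = ∑ i, b i * y i ^ 2 := hform
    _ ≤ b d * ∑ i, y i ^ 2 := by
        rw [Finset.mul_sum]
        refine Finset.sum_le_sum fun i _ => ?_
        rcases lt_or_ge i d with hi | hi
        · simp [hvB i hi]
        · exact mul_le_mul_of_nonneg_right (hb hi) (sq_nonneg _)
    _ ≤ b d * (frobeniusSq (A⁻¹ * B).1 * ∑ i, x i ^ 2) := mul_le_mul_of_nonneg_left hyx (hb0 d)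
    _ = frobeniusSq (A⁻¹ * B).1 * b d * ∑ i, x i ^ 2 := by ring

variable {g : GL (Fin n) ℝ} {φ l : Fin n → ℝ} {t : ℝ} {U : orthogonalGroup (Fin n) ℝ}

theorem antitone_exp_mul (hφ : Antitone φ) (ht : 0 ≤ t) : Antitone fun i => Real.exp (φ i * t) :=
  fun _ _ hij => Real.exp_le_exp.2 (mul_le_mul_of_nonneg_right (hφ hij) ht)

theorem eigenvalue_pos (hU : expCurve g φ t = congruence U.1 (diagonal l)) (i : Fin n) : 0 < l i :=
  pos_of_posDef_congruence_diagonal (g := Unitary.toUnits U) (hU ▸ posDef_expCurve g φ t) i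

theorem eigenvalue_le (hφ : Antitone φ) (ht : 0 ≤ t) (hl : Antitone l)
    (hU : expCurve g φ t = congruence U.1 (diagonal l)) (i : Fin n) :
    l i ≤ frobeniusSq g.1 * Real.exp (φ i * t) := by
  have h := le_frobeniusSq_mul_of_congruence_diagonal_eq (A := Unitary.toUnits U) (B := g) hl
    (antitone_exp_mul hφ ht) (fun i => (Real.exp_pos _).le) hU.symm i
  rwa [← frobeniusSq_transpose, Units.val_mul, transpose_mul,
    show ((Unitary.toUnits U)⁻¹).1ᵀ = U.1 from transpose_transpose _, frobeniusSq_mul_orthogonal,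
    frobeniusSq_transpose] at h

theorem exp_le_eigenvalue (hφ : Antitone φ) (ht : 0 ≤ t) (hl : Antitone l)
    (hU : expCurve g φ t = congruence U.1 (diagonal l)) (i : Fin n) :
    Real.exp (φ i * t) ≤ frobeniusSq g⁻¹.1 * l i := by
  have h := le_frobeniusSq_mul_of_congruence_diagonal_eq (A := g) (B := Unitary.toUnits U)
    (antitone_exp_mul hφ ht) hl (fun i => (eigenvalue_pos hU i).le) hU i
  rwa [Units.val_mul, Unitary.val_toUnits_apply, frobeniusSq_mul_orthogonal] at h

theorem transpose_mul_eigenvectors_apply (hU : expCurve g φ t = congruence U.1 (diagonal l))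
    (i j : Fin n) :
    (g.1ᵀ * U.1) i j = Real.exp (-(φ i * t)) * ((g⁻¹.1 * U.1) i j * l j) := by
  have hcomm : diagonal (fun i => Real.exp (φ i * t)) * (g.1ᵀ * U.1) =
      g⁻¹.1 * U.1 * diagonal l := by
    have h := congrArg (fun X => g⁻¹.1 * (X * U.1)) hU
    simp only [expCurve, congruence, Matrix.mul_assoc,
      (mem_orthogonalGroup_iff' _ _).1 U.2, Matrix.mul_one] at h
    rw [Matrix.mul_assoc, ← h, ← Matrix.mul_assoc g⁻¹.1, Units.inv_mul, Matrix.one_mul]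
  have h := congrFun (congrFun hcomm i) j
  rw [diagonal_mul, mul_diagonal] at h
  rw [← h, ← mul_assoc, ← Real.exp_add, neg_add_cancel, Real.exp_zero, one_mul]

theorem abs_transpose_mul_eigenvectors_apply_le (hφ : Antitone φ) (ht : 0 ≤ t) (hl : Antitone l)
    (hU : expCurve g φ t = congruence U.1 (diagonal l)) (i j : Fin n) :
    |(g.1ᵀ * U.1) i j| ≤
      √(frobeniusSq g⁻¹.1) * frobeniusSq g.1 * Real.exp ((φ j - φ i) * t) := by
  have hentry := abs_apply_le_sqrt_frobeniusSq (g⁻¹.1 * U.1) i j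
  rw [frobeniusSq_mul_orthogonal] at hentry
  calc |(g.1ᵀ * U.1) i j| = Real.exp (-(φ i * t)) * (|(g⁻¹.1 * U.1) i j| * l j) := by
        rw [transpose_mul_eigenvectors_apply hU, abs_mul, abs_mul, Real.abs_exp,
          abs_of_pos (eigenvalue_pos hU j)]
    _ ≤ Real.exp (-(φ i * t)) *
          (√(frobeniusSq g⁻¹.1) * (frobeniusSq g.1 * Real.exp (φ j * t))) := by
        gcongr
        · exact (eigenvalue_pos hU j).le
        · exact eigenvalue_le hφ ht hl hU j
    _ = √(frobeniusSq g⁻¹.1) * frobeniusSq g.1 * Real.exp ((φ j - φ i) * t) := by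
        rw [sub_mul, sub_eq_neg_add, Real.exp_add]
        ring

theorem eventually_eigenvalue_lt (hφ : Antitone φ) {U : ℝ → orthogonalGroup (Fin n) ℝ}
    {l : ℝ → Fin n → ℝ} (hl : ∀ t, Antitone (l t))
    (hU : ∀ t, expCurve g φ t = congruence (U t).1 (diagonal (l t))) {i j : Fin n}
    (hij : φ j < φ i) : ∀ᶠ t in atTop, l t j < l t i := by
  have hlim := (tendsto_exp_mul_of_neg tendsto_id (sub_neg.2 hij)).const_mul
    (frobeniusSq g⁻¹.1 * frobeniusSq g.1)
  rw [mul_zero] at hlim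
  filter_upwards [hlim.eventually_lt_const one_pos, eventually_ge_atTop 0] with t hlt ht
  refine lt_of_mul_lt_mul_left ?_ (frobeniusSq_nonneg g⁻¹.1)
  calc frobeniusSq g⁻¹.1 * l t j
      ≤ frobeniusSq g⁻¹.1 * (frobeniusSq g.1 * Real.exp (φ j * t)) :=
        mul_le_mul_of_nonneg_left (eigenvalue_le hφ ht (hl t) (hU t) j) (frobeniusSq_nonneg _)
    _ = frobeniusSq g⁻¹.1 * frobeniusSq g.1 * Real.exp ((φ j - φ i) * t) * Real.exp (φ i * t) := by
        rw [mul_assoc (_ * _), ← Real.exp_add, ← add_mul, sub_add_cancel, mul_assoc]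
    _ < Real.exp (φ i * t) := mul_lt_of_lt_one_left (Real.exp_pos _) hlt
    _ ≤ frobeniusSq g⁻¹.1 * l t i := exp_le_eigenvalue hφ ht (hl t) (hU t) i

end Eigenvalues

section SpectralTail

variable {n : ℕ} (U : orthogonalGroup (Fin n) ℝ) (l : Fin n → ℝ)

theorem card_filter_roots_charpoly (r : ℝ) :
    ((congruence U.1 (diagonal l)).charpoly.roots.filter fun l' => r < l').card =
      (Finset.univ.filter fun i => r < l i).card := by
  have hroots : (congruence U.1 (diagonal l)).charpoly.roots = Finset.univ.val.map l := by
    rw [congruence, Matrix.mul_assoc, charpoly_mul_comm, Matrix.mul_assoc,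
      (mem_orthogonalGroup_iff' _ _).1 U.2, Matrix.mul_one, charpoly_diagonal]
    have h := Polynomial.roots_multiset_prod_X_sub_C (Finset.univ.val.map l)
    rwa [Multiset.map_map] at h
  rw [hroots, Multiset.filter_map, Multiset.card_map]
  rfl

theorem transpose_mulVec_congruence_diagonal_mulVec (v : Fin n → ℝ) (j : Fin n) :
    (U.1ᵀ *ᵥ (congruence U.1 (diagonal l) *ᵥ v)) j = l j * (U.1ᵀ *ᵥ v) j := by
  rw [congruence, Matrix.mul_assoc, mulVec_mulVec, ← Matrix.mul_assoc,
    (mem_orthogonalGroup_iff' _ _).1 U.2, Matrix.one_mul, ← mulVec_mulVec, mulVec_diagonal]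

theorem congruence_diagonal_mulVec_col (j : Fin n) :
    congruence U.1 (diagonal l) *ᵥ U.1.col j = l j • U.1.col j := by
  rw [← mulVec_single_one, congruence, mulVec_mulVec, Matrix.mul_assoc,
    (mem_orthogonalGroup_iff' _ _).1 U.2, Matrix.mul_one, ← mulVec_mulVec, diagonal_mulVec_single,
    mul_one, ← mulVec_smul, ← Pi.single_smul', smul_eq_mul, mul_one]

theorem eq_sum_smul_col (v : Fin n → ℝ) : v = ∑ j, (U.1ᵀ *ᵥ v) j • U.1.col j := by
  calc v = U.1 *ᵥ (U.1ᵀ *ᵥ v) := by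
        rw [mulVec_mulVec, (mem_orthogonalGroup_iff _ _).1 U.2, one_mulVec]
    _ = ∑ j, (U.1ᵀ *ᵥ v) j • U.1.col j := by
        simp only [mulVec_eq_sum, op_smul_eq_smul]
        rfl

variable {l}

theorem spectralTail_congruence_diagonal (hl : Antitone l) {d : ℕ} (hd : d ≤ n)
    (hgap : ∀ i j : Fin n, (i : ℕ) < d → d ≤ (j : ℕ) → l j < l i) :
    spectralTail (congruence U.1 (diagonal l)) d = coordKer U.1ᵀ fun i => (i : ℕ) < d := by
  refine le_antisymm (Submodule.span_le.2 ?_) fun v hv => ?_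
  · rintro v ⟨r, hv, hr⟩
    refine mem_coordKer.2 fun j hj => by_contra fun hne => ?_
    have hrj : r = l j := by
      have h := transpose_mulVec_congruence_diagonal_mulVec U l v j
      rw [hv, mulVec_smul, Pi.smul_apply, smul_eq_mul] at h
      exact mul_right_cancel₀ hne h
    rw [card_filter_roots_charpoly, hrj] at hr
    exact ((Tuple.lt_card_gt_iff_apply_gt_of_antitone hl).1 (hj.trans_le hr)).false
  · rw [eq_sum_smul_col U v]
    refine Submodule.sum_mem _ fun j _ => ?_
    rcases lt_or_ge (j : ℕ) d with hj | hj
    · rw [mem_coordKer.1 hv j hj, zero_smul]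
      exact Submodule.zero_mem _
    · refine Submodule.smul_mem _ _
        (Submodule.subset_span ⟨l j, congruence_diagonal_mulVec_col U l j, ?_⟩)
      rw [card_filter_roots_charpoly]
      calc d = (Finset.univ.filter fun i : Fin n => (i : ℕ) < d).card := by
            rw [Fin.card_filter_val_lt, min_eq_right hd]
        _ ≤ (Finset.univ.filter fun i => l j < l i).card :=
            Finset.card_le_card (Finset.monotone_filter_right _ fun i _ hi => hgap i j hi hj)

end SpectralTail

section SpectralLimits

variable {n : ℕ} {I : CompositionAsSet n} (g : GL (Fin n) ℝ) (ψ : Speeds I)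

theorem exists_eigenvectors_expCurve :
    ∃ (U : ℝ → orthogonalGroup (Fin n) ℝ) (K : ℝ), 0 ≤ K ∧
      (∀ t, 0 ≤ t → ∀ i j, |(g.1ᵀ * (U t).1) i j| ≤
        K * Real.exp ((ψ.1 (block I j) - ψ.1 (block I i)) * t)) ∧
      ∀ k, ∀ᶠ t in atTop, spectralTail (expCurve g (fun i => ψ.1 (block I i)) t) (cut I k) =
        coordKer (U t).1ᵀ fun i => (block I i).castSucc < k := by
  have hφ : Antitone fun i => ψ.1 (block I i) := ψ.2.1.antitone.comp_monotone (block_mono I)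
  choose U l hl hU using fun t => exists_antitone_diagonalization
    (isSymm_of_posDef (posDef_expCurve g (fun i => ψ.1 (block I i)) t))
  refine ⟨U, √(frobeniusSq g⁻¹.1) * frobeniusSq g.1,
    mul_nonneg (Real.sqrt_nonneg _) (frobeniusSq_nonneg _),
    fun t ht i j => abs_transpose_mul_eigenvectors_apply_le hφ ht (hl t) (hU t) i j, fun k => ?_⟩
  have hgap : ∀ᶠ t in atTop, ∀ i j, block I i < block I j → l t j < l t i := by
    simp only [eventually_all]
    exact fun i j hij => eventually_eigenvalue_lt hφ hl hU (ψ.2.1 hij)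
  filter_upwards [hgap] with t ht
  rw [hU t, spectralTail_congruence_diagonal (U t) (hl t) (Fin.is_le _) fun i j hi hj => ht i j ?_]
  · simp only [lt_cut_iff]
  · rw [lt_cut_iff] at hi
    rw [← not_lt, lt_cut_iff, not_lt] at hj
    exact Fin.castSucc_lt_castSucc_iff.1 (hi.trans_le hj)

theorem sum_transpose_orthogonal_mulVec_sq (U : orthogonalGroup (Fin n) ℝ) (v : Fin n → ℝ) :
    ∑ i, (U.1ᵀ *ᵥ v) i ^ 2 = ∑ i, v i ^ 2 := by
  have h := quadForm_congruence U.1 1 v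
  rw [congruence_orthogonal_one, quadForm_one, quadForm_one] at h
  linarith

theorem exists_spectralTail_bound (k : Fin I.length) :
    ∃ K : ℝ, ∀ᶠ t in atTop, ∀ v ∈ spectralTail (expCurve g (fun i => ψ.1 (block I i)) t)
        (cut I k.castSucc), ∀ i,
      |(g.1ᵀ *ᵥ v) i| ≤ K * √(∑ j, v j ^ 2) * Real.exp ((ψ.1 k - ψ.1 (block I i)) * t) := by
  obtain ⟨U, K, hK, hbound, htail⟩ := exists_eigenvectors_expCurve g ψ
  refine ⟨n * K, ?_⟩
  filter_upwards [htail k.castSucc, eventually_ge_atTop 0] with t ht ht0 v hv i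
  rw [ht, mem_coordKer] at hv
  set y := (U t).1ᵀ *ᵥ v with hy
  have hgv : g.1ᵀ *ᵥ v = (g.1ᵀ * (U t).1) *ᵥ y := by
    rw [hy, mulVec_mulVec, Matrix.mul_assoc, (mem_orthogonalGroup_iff _ _).1 (U t).2,
      Matrix.mul_one]
  have hterm (j : Fin n) : |(g.1ᵀ * (U t).1) i j * y j| ≤
      K * √(∑ j, v j ^ 2) * Real.exp ((ψ.1 k - ψ.1 (block I i)) * t) := by
    rcases lt_or_ge (block I j) k with hj | hj
    · rw [hv j (Fin.castSucc_lt_castSucc_iff.2 hj), mul_zero, abs_zero]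
      positivity
    · rw [abs_mul, mul_right_comm, ← sum_transpose_orthogonal_mulVec_sq (U t)]
      refine mul_le_mul ((hbound t ht0 i j).trans ?_) (abs_le_sqrt_sum_sq y j) (abs_nonneg _)
        (by positivity)
      gcongr
      exact ψ.2.1.antitone hj
  calc |(g.1ᵀ *ᵥ v) i| ≤ ∑ j, |(g.1ᵀ * (U t).1) i j * y j| := by
        rw [hgv, mulVec, dotProduct]
        exact Finset.abs_sum_le_sum_abs _ _
    _ ≤ n * K * √(∑ j, v j ^ 2) * Real.exp ((ψ.1 k - ψ.1 (block I i)) * t) := by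
        refine (Finset.sum_le_card_nsmul _ _ _ fun j _ => hterm j).trans_eq ?_
        rw [Finset.card_univ, Fintype.card_fin, nsmul_eq_mul]
        ring

variable {g ψ} {k : Fin I.length} {v : ℝ → Fin n → ℝ} {w : Fin n → ℝ}

theorem exists_tendsto_bound_of_mem_spectralTail (hv : Tendsto v atTop (𝓝 w))
    (hmem : ∀ᶠ t in atTop,
      v t ∈ spectralTail (expCurve g (fun i => ψ.1 (block I i)) t) (cut I k.castSucc)) :
    ∃ (C : ℝ → ℝ) (c : ℝ), Tendsto C atTop (𝓝 c) ∧ ∀ᶠ t in atTop, ∀ i,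
      |(g.1ᵀ *ᵥ v t) i| ≤ C t * Real.exp ((ψ.1 k - ψ.1 (block I i)) * t) := by
  obtain ⟨K, hK⟩ := exists_spectralTail_bound g ψ k
  refine ⟨fun t => K * √(∑ j, v t j ^ 2), K * √(∑ j, w j ^ 2), ?_, ?_⟩
  · exact (tendsto_finsetSum _ fun j _ => (tendsto_pi_nhds.1 hv j).pow 2).sqrt.const_mul K
  · filter_upwards [hK, hmem] with t h ht
    exact h _ ht

theorem tendsto_transpose_mulVec (hv : Tendsto v atTop (𝓝 w)) :
    Tendsto (fun t => g.1ᵀ *ᵥ v t) atTop (𝓝 (g.1ᵀ *ᵥ w)) :=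
  ((continuous_const.matrix_mulVec continuous_id).tendsto w).comp hv

theorem transpose_mulVec_eq_zero_of_mem_spectralTail (hv : Tendsto v atTop (𝓝 w))
    (hmem : ∀ᶠ t in atTop,
      v t ∈ spectralTail (expCurve g (fun i => ψ.1 (block I i)) t) (cut I k.castSucc))
    {i : Fin n} (hi : block I i < k) : (g.1ᵀ *ᵥ w) i = 0 := by
  obtain ⟨C, c, hC, hbound⟩ := exists_tendsto_bound_of_mem_spectralTail hv hmem
  have hlim := hC.mul (tendsto_exp_mul_of_neg tendsto_id (sub_neg.2 (ψ.2.1 hi)))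
  rw [mul_zero] at hlim
  exact tendsto_nhds_unique (tendsto_pi_nhds.1 (tendsto_transpose_mulVec hv) i)
    (squeeze_zero_norm' (hbound.mono fun t ht => ht i) hlim)

theorem tendsto_quadForm_of_mem_spectralTail (hv : Tendsto v atTop (𝓝 w))
    (hmem : ∀ᶠ t in atTop,
      v t ∈ spectralTail (expCurve g (fun i => ψ.1 (block I i)) t) (cut I k.castSucc)) :
    Tendsto (fun t => Real.exp (-(ψ.1 k * t)) *
        quadForm (expCurve g (fun i => ψ.1 (block I i)) t) (v t)) atTop
      (𝓝 (1 / 2 * ∑ i with block I i = k, (g.1ᵀ *ᵥ w) i ^ 2)) := by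
  obtain ⟨C, c, hC, hbound⟩ := exists_tendsto_bound_of_mem_spectralTail hv hmem
  simp only [quadForm_expCurve, ← ψ.filter_eq]
  refine tendsto_exp_neg_mul_sum tendsto_id _ _ (tendsto_transpose_mulVec hv) fun i hi => ?_
  -- The square of the bound decays at twice the rate at which the weight grows.
  have hlim := (hC.pow 2).mul (tendsto_exp_mul_of_neg tendsto_id (sub_neg.2 hi))
  rw [mul_zero] at hlim
  refine squeeze_zero' (Eventually.of_forall fun t => by positivity) ?_ hlim
  filter_upwards [hbound] with t ht
  calc Real.exp ((ψ.1 (block I i) - ψ.1 k) * t) * (g.1ᵀ *ᵥ v t) i ^ 2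
      ≤ Real.exp ((ψ.1 (block I i) - ψ.1 k) * t) *
          (C t * Real.exp ((ψ.1 k - ψ.1 (block I i)) * t)) ^ 2 := by
        rw [← sq_abs]
        gcongr
        exact ht i
    _ = C t ^ 2 * Real.exp ((ψ.1 k - ψ.1 (block I i)) * t) := by
        rw [mul_pow, mul_left_comm, ← Real.exp_nat_mul, ← Real.exp_add]
        push_cast
        ring_nf

end SpectralLimits

section LimitData

variable {n : ℕ}

theorem tendsto_orthogonal_inv_mulVec {h : ℝ → orthogonalGroup (Fin n) ℝ}
    (hh : Tendsto (fun t => (h t).1) atTop (𝓝 1)) (w : Fin n → ℝ) :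
    Tendsto (fun t => (h t).1⁻¹ *ᵥ w) atTop (𝓝 w) := by
  have hlim := ((continuous_id.matrix_mulVec (continuous_const (y := w))).tendsto _).comp
    (tendsto_inv isUnit_one hh)
  simpa [Function.comp_def] using hlim

theorem orthogonal_inv_mulVec_mem {h : orthogonalGroup (Fin n) ℝ} {V W : Submodule ℝ (Fin n → ℝ)}
    (hVW : V.map (toLin' h.1) = W) {w : Fin n → ℝ} (hw : w ∈ W) : h.1⁻¹ *ᵥ w ∈ V := by
  obtain ⟨v, hv, rfl⟩ := hVW ▸ hw
  rwa [toLin'_apply, mulVec_mulVec, nonsing_inv_mul _ (UnitaryGroup.det_isUnit h), one_mulVec]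

variable {μ : ParamGeodesic n} {I : CompositionAsSet n} {ψ : Speeds I} {W : Flag I} {R : Forms W}

theorem HasLimitData.hasFrame (hμ : HasLimitData μ ψ W R) : HasFrame μ ψ W R := by
  obtain ⟨hvel, hlim⟩ := hμ
  obtain ⟨g, hg⟩ := (hasVelocity_iff I μ ψ).1 hvel
  rw [hg] at hlim
  choose h hh hmap hR using hlim
  have hmem (k : Fin I.length) (v : W.1 k.castSucc) : ∀ᶠ t in atTop, (h k t).1⁻¹ *ᵥ v.1 ∈
      spectralTail (expCurve g (fun i => ψ.1 (block I i)) t) (cut I k.castSucc) :=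
    (hmap k).mono fun t ht => orthogonal_inv_mulVec_mem ht v.2
  obtain ⟨W', hW'⟩ := exists_flag I g
  have hle (k : Fin (I.length + 1)) : W.1 k ≤ W'.1 k := by
    induction k using Fin.lastCases with
    | last => exact W.last_eq_bot.trans_le bot_le
    | cast k =>
      exact fun v hv => (hW' _ v).2 fun i hi => transpose_mulVec_eq_zero_of_mem_spectralTail
        (tendsto_orthogonal_inv_mulVec (hh k) v) (hmem k ⟨v, hv⟩)
        (Fin.castSucc_lt_castSucc_iff.1 hi)
  refine ⟨g, hg, fun k => ?_, fun k v => tendsto_nhds_unique (hR k v)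
    (tendsto_quadForm_of_mem_spectralTail (tendsto_orthogonal_inv_mulVec (hh k) v) (hmem k v))⟩
  rw [Submodule.eq_of_le_of_finrank_eq (hle k)
    (Nat.add_right_cancel ((W.2.2 k).trans (W'.2.2 k).symm))]
  exact hW' k

end LimitData

section OrthogonalIdentification

theorem exists_choice_tendsto_zero {α X : Type*} {l : Filter α} [l.NeBot] {P : α → X → Prop}
    {δ : X → ℝ} {ε : α → ℝ} (hδ : ∀ x, 0 ≤ δ x) (hε : ∀ a, 0 < ε a) (hεl : Tendsto ε l (𝓝 0))
    (h : ∀ F : Ultrafilter α, ↑F ≤ l →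
      ∃ x : α → X, (∀ a, P a (x a)) ∧ Tendsto (fun a => δ (x a)) F (𝓝 0)) :
    ∃ x : α → X, (∀ a, P a (x a)) ∧ Tendsto (fun a => δ (x a)) l (𝓝 0) := by
  -- A choice that minimizes `δ` up to `ε` does at least as well along every ultrafilter.
  have hmin (a : α) : ∃ x, P a x ∧ ∀ x', P a x' → δ x ≤ δ x' + ε a := by
    obtain ⟨x₀, hx₀, -⟩ := h (Ultrafilter.of l) (Ultrafilter.of_le l)
    obtain ⟨_, ⟨x, hx, rfl⟩, hlt⟩ := exists_lt_of_csInf_lt (s := δ '' {x | P a x})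
      ⟨_, x₀ a, hx₀ a, rfl⟩ (lt_add_of_pos_right _ (hε a))
    have hbdd : BddBelow (δ '' {x | P a x}) := ⟨0, Set.forall_mem_image.2 fun x _ => hδ x⟩
    exact ⟨x, hx, fun x' hx' =>
      hlt.le.trans (add_le_add_left (csInf_le hbdd (Set.mem_image_of_mem δ hx')) _)⟩
  choose x hx hxmin using hmin
  refine ⟨x, hx, (tendsto_iff_ultrafilter _ _ _).2 fun F hF => ?_⟩
  obtain ⟨x', hx', hlim⟩ := h F hF
  have hbound : Tendsto (fun a => δ (x' a) + ε a) F (𝓝 0) := by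
    simpa using hlim.add (hεl.mono_left hF)
  exact squeeze_zero (fun a => hδ _) (fun a => hxmin a _ (hx' a)) hbound

variable {n : ℕ}

theorem exists_tendsto_orthogonal {α : Type*} (F : Ultrafilter α)
    (U : α → orthogonalGroup (Fin n) ℝ) :
    ∃ V : orthogonalGroup (Fin n) ℝ, Tendsto (fun a => (U a).1) F (𝓝 V.1) := by
  have hcompact : IsCompact (Set.univ.pi fun _ : Fin n => Set.univ.pi fun _ : Fin n =>
      Set.Icc (-1 : ℝ) 1) := isCompact_univ_pi fun _ => isCompact_univ_pi fun _ => isCompact_Icc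
  obtain ⟨V, -, hV⟩ := isCompact_iff_ultrafilter_le_nhds.1 hcompact (F.map fun a => (U a).1)
    (le_principal_iff.2 (mem_map.2 (univ_mem' fun a i _ j _ =>
      abs_le.1 (entry_norm_bound_of_unitary (U a).2 i j))))
  have hlim : Tendsto (fun a => (U a).1) F (𝓝 (V : Matrix (Fin n) (Fin n) ℝ)) := hV
  have hlimT : Tendsto (fun a => (U a).1ᵀ) F (𝓝 (Matrix.transpose V)) :=
    ((continuous_id.matrix_transpose).tendsto V).comp hlim
  refine ⟨⟨V, (mem_orthogonalGroup_iff _ _).2 (tendsto_nhds_unique (hlim.mul hlimT) ?_)⟩, hlim⟩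
  simp only [(mem_orthogonalGroup_iff _ _).1 (U _).2]
  exact tendsto_const_nhds

theorem map_coordKer_orthogonal {g : GL (Fin n) ℝ} {p : Fin n → Prop}
    {U V : orthogonalGroup (Fin n) ℝ} (hV : ∀ i j, p i → ¬ p j → (g.1ᵀ * V.1) i j = 0) :
    (coordKer U.1ᵀ p).map (toLin' (V * U⁻¹).1) = coordKer g.1ᵀ p := by
  classical
  refine Submodule.eq_of_le_of_finrank_eq ?_ ?_
  · rintro _ ⟨v, hv, rfl⟩
    refine mem_coordKer.2 fun i hi => ?_
    rw [toLin'_apply, UnitaryGroup.mul_val, ← mulVec_mulVec, mulVec_mulVec, mulVec, dotProduct]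
    refine Finset.sum_eq_zero fun j _ => ?_
    by_cases hj : p j
    · exact mul_eq_zero_of_right _ (mem_coordKer.1 hv j hj)
    · exact mul_eq_zero_of_left (hV i j hi hj) _
  · have hinj : Function.Injective (toLin' (V * U⁻¹).1) :=
      mulVec_injective_iff_isUnit.2 (Unitary.toUnits (V * U⁻¹)).isUnit
    rw [← (Submodule.equivMapOfInjective _ hinj _).finrank_eq]
    exact Nat.add_right_cancel
      ((finrank_coordKer ((isUnit_transpose _).2 (Unitary.toUnits U).isUnit) p).trans
        (finrank_coordKer ((isUnit_transpose _).2 g.isUnit) p).symm)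

theorem frobeniusSq_mul_inv_sub_one (U V : orthogonalGroup (Fin n) ℝ) :
    frobeniusSq ((V * U⁻¹).1 - 1) = frobeniusSq (V.1 - U.1) := by
  rw [← frobeniusSq_mul_orthogonal _ U, sub_mul, one_mul, ← UnitaryGroup.mul_val,
    inv_mul_cancel_right]

theorem tendsto_frobeniusSq_sub {α : Type*} {l : Filter α} {A : α → Matrix (Fin n) (Fin n) ℝ}
    {B : Matrix (Fin n) (Fin n) ℝ} (h : Tendsto A l (𝓝 B)) :
    Tendsto (fun a => frobeniusSq (B - A a)) l (𝓝 0) := by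
  have hlim : Tendsto (fun a => ∑ i, ∑ j, (B i j - A a i j) ^ 2) l
      (𝓝 (∑ i, ∑ j, (B i j - B i j) ^ 2)) :=
    tendsto_finsetSum _ fun i _ => tendsto_finsetSum _ fun j _ =>
      ((tendsto_matrix_iff.1 h i j).const_sub _).pow 2
  simp only [sub_self, zero_pow two_ne_zero, Finset.sum_const_zero] at hlim
  exact hlim

theorem exists_orthogonal_tendsto_one (U : ℝ → orthogonalGroup (Fin n) ℝ) (g : GL (Fin n) ℝ)
    (p : Fin n → Prop)
    (hoff : ∀ i j, p i → ¬ p j → Tendsto (fun t => (g.1ᵀ * (U t).1) i j) atTop (𝓝 0)) :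
    ∃ h : ℝ → orthogonalGroup (Fin n) ℝ, Tendsto (fun t => (h t).1) atTop (𝓝 1) ∧
      ∀ t, (coordKer (U t).1ᵀ p).map (toLin' (h t).1) = coordKer g.1ᵀ p := by
  obtain ⟨h, hmap, hlim⟩ := exists_choice_tendsto_zero (l := atTop)
    (P := fun t (h : orthogonalGroup (Fin n) ℝ) =>
      (coordKer (U t).1ᵀ p).map (toLin' h.1) = coordKer g.1ᵀ p)
    (δ := fun h => frobeniusSq (h.1 - 1)) (fun _ => frobeniusSq_nonneg _)
    (fun t : ℝ => Real.exp_pos (-t)) Real.tendsto_exp_neg_atTop_nhds_zero fun F hF => by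
      obtain ⟨V, hV⟩ := exists_tendsto_orthogonal F U
      refine ⟨fun t => V * (U t)⁻¹, fun t => map_coordKer_orthogonal fun i j hi hj => ?_, ?_⟩
      · exact tendsto_nhds_unique (tendsto_matrix_iff.1 (hV.const_mul _) i j)
          ((hoff i j hi hj).mono_left hF)
      · simpa only [frobeniusSq_mul_inv_sub_one] using tendsto_frobeniusSq_sub hV
  refine ⟨h, tendsto_matrix_iff.2 fun i j => ?_, hmap⟩
  have hsqrt := hlim.sqrt
  rw [Real.sqrt_zero] at hsqrt
  exact tendsto_iff_norm_sub_tendsto_zero.2 (squeeze_zero (fun _ => norm_nonneg _)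
    (fun t => abs_apply_le_sqrt_frobeniusSq ((h t).1 - 1) i j) hsqrt)

variable {μ : ParamGeodesic n} {I : CompositionAsSet n} {ψ : Speeds I} {W : Flag I} {R : Forms W}

theorem HasFrame.hasLimitData (hμ : HasFrame μ ψ W R) : HasLimitData μ ψ W R := by
  obtain ⟨g, hg, hframe⟩ := hμ
  refine ⟨(hasVelocity_iff I μ ψ).2 ⟨g, hg⟩, fun k => ?_⟩
  obtain ⟨U, K, -, hbound, htail⟩ := exists_eigenvectors_expCurve g ψ
  obtain ⟨h, hh, hmap⟩ := exists_orthogonal_tendsto_one U g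
    (fun i => (block I i).castSucc < k.castSucc) fun i j hi hj => by
      have hij : block I i < block I j :=
        Fin.castSucc_lt_castSucc_iff.1 (hi.trans_le (not_lt.1 hj))
      have hlim := (tendsto_exp_mul_of_neg tendsto_id (sub_neg.2 (ψ.2.1 hij))).const_mul K
      rw [mul_zero] at hlim
      exact squeeze_zero_norm' ((eventually_ge_atTop 0).mono fun t ht => hbound t ht i j) hlim
  have hW : coordKer g.1ᵀ (fun i => (block I i).castSucc < k.castSucc) = W.1 k.castSucc :=
    Submodule.ext fun v => mem_coordKer.trans (hframe.mem_iff _ v).symm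
  have htailmap : ∀ᶠ t in atTop,
      (spectralTail (expCurve g (fun i => ψ.1 (block I i)) t) (cut I k.castSucc)).map
        (toLin' (h t).1) = W.1 k.castSucc :=
    (htail k.castSucc).mono fun t ht => by rw [ht, hmap, hW]
  rw [hg]
  refine ⟨h, hh, htailmap, fun v => ?_⟩
  rw [hframe.form_eq]
  exact tendsto_quadForm_of_mem_spectralTail (tendsto_orthogonal_inv_mulVec hh v)
    (htailmap.mono fun t ht => orthogonal_inv_mulVec_mem ht v.2)

end OrthogonalIdentification

section Classification

variable {n : ℕ} {μ ν : ParamGeodesic n} {b b' : BoundaryData n}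

theorem hasBoundaryData_iff : HasBoundaryData μ b ↔ HasFrameData μ b :=
  exists_congr fun _ => exists_congr fun _ =>
    and_congr_left fun _ => ⟨HasLimitData.hasFrame, HasFrame.hasLimitData⟩

theorem exists_hasBoundaryData (μ : ParamGeodesic n) : ∃ b, HasBoundaryData μ b := by
  obtain ⟨g, φ, hφ, h0, hμ⟩ := μ.exists_eq_expCurve
  obtain ⟨I, ψ, rfl⟩ := exists_speeds hφ h0
  obtain ⟨W, R, hframe⟩ := exists_isFrame I g
  exact ⟨⟨I, ψ.toSimplex, W, Quotient.mk _ R⟩,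
    hasBoundaryData_iff.2 ⟨ψ, R, ⟨g, hμ, hframe⟩, rfl, rfl⟩⟩

theorem exists_geodesic_hasBoundaryData (b : BoundaryData n) :
    ∃ μ : ParamGeodesic n, HasBoundaryData μ b := by
  obtain ⟨ψ, hψ⟩ := Quotient.exists_rep b.δ
  obtain ⟨R, hR⟩ := Quotient.exists_rep b.R
  obtain ⟨g, hframe⟩ := exists_frame b.W R
  obtain ⟨μ, hμ⟩ := exists_paramGeodesic g (φ := fun i => ψ.1 (block b.I i)) fun h0 =>
    ψ.2.2 ((block_surjective b.I).injective_comp_right h0)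
  exact ⟨μ, hasBoundaryData_iff.2 ⟨ψ, R, ⟨g, hμ, hframe⟩, hψ, hR⟩⟩

theorem HasBoundaryData.unique (h : HasBoundaryData μ b) (h' : HasBoundaryData μ b') : b = b' :=
  (hasBoundaryData_iff.1 h).unique (hasBoundaryData_iff.1 h')

theorem HasBoundaryData.nullAsymptotic_iff (hμ : HasBoundaryData μ b) (hν : HasBoundaryData ν b') :
    NullAsymptotic μ ν ↔ b = b' := by
  rw [hasBoundaryData_iff] at hμ hν
  refine ⟨hμ.eq_of_nullAsymptotic hν, ?_⟩
  rintro rfl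
  exact hμ.nullAsymptotic hν

theorem nullAsymptotic_of_toDirected_eq (h : μ.toDirected = ν.toDirected) :
    NullAsymptotic μ ν := by
  obtain ⟨a, c, ha, hac⟩ : (directedSetoid n).r ν μ := Quotient.exact h.symm
  refine nullAsymptotic_of_tendsto (s := fun t => a * t + c)
    (tendsto_atTop_add_const_right _ _ (tendsto_id.const_mul_atTop ha)) ?_
  simp only [hac, rho_self (ν.posDef _)]
  exact tendsto_const_nhds

theorem HasBoundaryData.of_toDirected_eq (hμ : HasBoundaryData μ b)
    (h : μ.toDirected = ν.toDirected) : HasBoundaryData ν b := by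
  obtain ⟨b', hν⟩ := exists_hasBoundaryData ν
  rwa [(hμ.nullAsymptotic_iff hν).1 (nullAsymptotic_of_toDirected_eq h)]

theorem HasBoundaryData.nullPencil_eq_iff (hμ : HasBoundaryData μ b) (hν : HasBoundaryData ν b') :
    nullPencil μ = nullPencil ν ↔ b = b' := by
  constructor
  · intro h
    have hmem : ν.toDirected ∈ nullPencil ν := ⟨ν, rfl, (hν.nullAsymptotic_iff hν).2 rfl⟩
    obtain ⟨κ, hκ, hnull⟩ := h ▸ hmem
    exact (hμ.nullAsymptotic_iff (hν.of_toDirected_eq hκ.symm)).1 hnull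
  · rintro rfl
    ext N
    refine exists_congr fun κ => and_congr_right fun _ => ?_
    obtain ⟨b', hκ⟩ := exists_hasBoundaryData κ
    rw [hμ.nullAsymptotic_iff hκ, hν.nullAsymptotic_iff hκ]

end Classification

end PosDefSpace

end

theorem theorem3p9 (n : ℕ) :
    ∃ Φ : PosDefSpace.NullPencil n ≃ PosDefSpace.BoundaryData n,
      ∀ (μ : PosDefSpace.ParamGeodesic n) (b : PosDefSpace.BoundaryData n),
        PosDefSpace.HasBoundaryData μ b ↔ Φ μ.toNullPencil = b := by
  choose datum hdatum using PosDefSpace.exists_hasBoundaryData (n := n)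
  choose rep hrep using fun P : PosDefSpace.NullPencil n => P.2
  have hval (μ : PosDefSpace.ParamGeodesic n) : datum (rep μ.toNullPencil) = datum μ :=
    ((hdatum _).nullPencil_eq_iff (hdatum _)).1 (hrep _)
  have hinj : Function.Injective fun P => datum (rep P) := fun P Q h =>
    Subtype.ext <| calc P.1 = PosDefSpace.nullPencil (rep P) := (hrep P).symm
      _ = PosDefSpace.nullPencil (rep Q) := ((hdatum _).nullPencil_eq_iff (hdatum _)).2 h
      _ = Q.1 := hrep Q
  have hsurj : Function.Surjective fun P => datum (rep P) := fun b => by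
    obtain ⟨μ, hμ⟩ := PosDefSpace.exists_geodesic_hasBoundaryData b
    exact ⟨μ.toNullPencil, (hval μ).trans ((hdatum μ).unique hμ)⟩
  refine ⟨Equiv.ofBijective _ ⟨hinj, hsurj⟩, fun μ b => ?_⟩
  change _ ↔ datum (rep μ.toNullPencil) = b
  rw [hval]
  exact ⟨(hdatum μ).unique, fun h => h ▸ hdatum μ⟩
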